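/- Let $n\ge 1$ and let $R=R_1\cup\dots\cup R_n$ be a chain of $n$ projective lines over $\mathbb{C}$: a reduced $\mathbb{C}$-scheme that is the union of closed subschemes $R_i\cong\mathbb{P}^1$ such that $R_i\cap R_{i+1}$ is (scheme-theoretically) a single reduced point for $1\le i<n$ and $R_i\cap R_j=\emptyset$ for $|i-j|\ge 2$. Let $p_1\in R_1$ and $p_{n+1}\in R_n$ be two distinct closed points at which $R$ is smooth, i.e. points lying on no other component. Let $\mathcal{E}=\mathcal{L}_1\oplus\dots\oplus\mathcal{L}_n$ be the rank $n$ strictly standard Gieseker bundle on $R$, that is, $\mathcal{L}_i$ is a line bundle on $R$ with $\mathcal{L}_i|_{R_i}\cong\mathcal{O}(1)$ and $\mathcal{L}_i|_{R_j}\cong\mathcal{O}$ for $j\ne i$. Put $T=\prod_{i=1}^n \mathrm{Aut}(\mathcal{L}_i)$. Let $B^+\subset \mathrm{Aut}(\mathcal{E}_{p_1})$ be the stabilizer of the flag with members $\mathcal{L}_{1,p_1}\oplus\dots\oplus\mathcal{L}_{k,p_1}$, and $B^-\subset\mathrm{Aut}(\mathcal{E}_{p_{n+1}})$ the stabilizer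 of the flag with members $\mathcal{L}_{k,p_{n+1}}\oplus\dots\oplus\mathcal{L}_{n,p_{n+1}}$ ($1\le k\le n$). Then: (1) the evaluation homomorphism $\mathrm{Aut}(\mathcal{E})\to \mathrm{Aut}(\mathcal{E}_{p_1})\times\mathrm{Aut}(\mathcal{E}_{p_{n+1}})$, $\sigma\mapsto(\sigma_{p_1},\sigma_{p_{n+1}})$, is injective; (2) there are unique group homomorphisms $q^+:B^+\to T$ and $q^-:B^-\to T$ such that for all $b\in B^{\pm}$ and all $i$ the diagonal component $\mathcal{L}_{i,p}\hookrightarrow\mathcal{E}_{p}\xrightarrow{\,b\,}\mathcal{E}_{p}\twoheadrightarrow\mathcal{L}_{i,p}$ (with $p=p_1$ for $B^+$ and $p=p_{n+1}$ for $B^-$) is the value at $p$ of the automorphism $q^{\pm}(b)_i$ of $\mathcal{L}_i$; and, with $q=q^+\times q^-:B^+\times B^-\to T\times T$ and $\Delta\subset T\times T$ the diagonal, the image of the evaluation homomorphism in (1) is $q^{-1}(\Delta)$. -/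

import Mathlib

open CategoryTheory AlgebraicGeometry

noncomputable section

namespace GiesekerChain

/-! ### The projective line over `ℂ` -/

/-- The standard grading of `ℂ[x₀, x₁]`. -/
abbrev grading : ℕ → Submodule ℂ (MvPolynomial (Fin 2) ℂ) :=
  MvPolynomial.homogeneousSubmodule (Fin 2) ℂ

instance : GradedAlgebra grading := MvPolynomial.gradedAlgebra

/-- The complex projective line `Proj ℂ[x₀, x₁]`. -/
abbrev P1 : Scheme.{0} := Proj grading

/-- The structure morphism `ℙ¹ ⟶ Spec ℂ`. -/
def P1.str : P1 ⟶ Spec (.of ℂ) :=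
  Proj.toSpecZero grading ≫ Spec.map (CommRingCat.ofHom (algebraMap ℂ (grading 0)))

/-- The standard affine open `D₊(xᵢ)` of `ℙ¹`. -/
abbrev P1.chart (i : Fin 2) : P1.Opens := Proj.basicOpen grading (MvPolynomial.X i)

/-- The regular function `x₁ / x₀` on `D₊(x₀)`. -/
def P1.coord : Γ(P1, P1.chart 0) :=
  Proj.awayToSection grading (MvPolynomial.X 0)
    (HomogeneousLocalization.Away.mk grading
      (MvPolynomial.isHomogeneous_X ℂ (0 : Fin 2)) 1 (MvPolynomial.X 1)
      (MvPolynomial.isHomogeneous_X ℂ (1 : Fin 2)))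

/-! ### Line bundles -/

/-- The section `e` of the `𝒪_X`-module `M` over `U` is a frame: multiplication by `e` is an
isomorphism `𝒪_U ≅ M|_U`. -/
def IsFrame {X : Scheme.{0}} (M : X.Modules) (U : X.Opens) (e : Γ(M, U)) : Prop :=
  ∀ (V : X.Opens) (h : V ≤ U),
    Function.Bijective fun f : Γ(X, V) => f • (M.presheaf.map (homOfLE h).op e : Γ(M, V))

/-- A line bundle: an `𝒪_X`-module that is locally free of rank one. -/
def IsLineBundle {X : Scheme.{0}} (M : X.Modules) : Prop :=
  ∀ x : X, ∃ U : X.Opens, x ∈ U ∧ ∃ e : Γ(M, U), IsFrame M U e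

/-- `M` is isomorphic to `𝒪(d)` on `ℙ¹`: there are frames `e₀` over `D₊(x₀)` and `e₁` over
`D₊(x₁)` (corresponding to `x₀ ^ d` and `x₁ ^ d`) with `e₁ = (x₁ / x₀) ^ d • e₀` over the
intersection. For `d = 0` this says that `M` is trivial. -/
def IsTwist (M : P1.Modules) (d : ℕ) : Prop :=
  ∃ (e₀ : Γ(M, P1.chart 0)) (e₁ : Γ(M, P1.chart 1)),
    IsFrame M (P1.chart 0) e₀ ∧ IsFrame M (P1.chart 1) e₁ ∧
      (M.presheaf.map (homOfLE (inf_le_right : P1.chart 0 ⊓ P1.chart 1 ≤ P1.chart 1)).op e₁ :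
          Γ(M, P1.chart 0 ⊓ P1.chart 1)) =
        (P1.presheaf.map (homOfLE (inf_le_left : P1.chart 0 ⊓ P1.chart 1 ≤ P1.chart 0)).op
            P1.coord : Γ(P1, P1.chart 0 ⊓ P1.chart 1)) ^ d •
          (M.presheaf.map (homOfLE (inf_le_left : P1.chart 0 ⊓ P1.chart 1 ≤ P1.chart 0)).op e₀ :
            Γ(M, P1.chart 0 ⊓ P1.chart 1))

/-! ### Chains of projective lines -/

/-- A chain of `n` projective lines over `ℂ`: a reduced `ℂ`-scheme `R` that is the union of
closed subschemes `R_i ≅ ℙ¹`, where consecutive components meet (scheme-theoretically) in a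
single reduced point and all other pairs of distinct components are disjoint. -/
structure Chain (n : ℕ) where
  R : Scheme.{0}
  str : R ⟶ Spec (.of ℂ)
  isReduced : IsReduced R
  comp : Fin n → (P1 ⟶ R)
  isClosedImmersion (i : Fin n) : IsClosedImmersion (comp i)
  comp_str (i : Fin n) : comp i ≫ str = P1.str
  covers (x : R) : ∃ i, x ∈ Set.range (comp i)
  meet (i j : Fin n) (h : i.val + 1 = j.val) :
    IsIso (Limits.pullback.fst (comp i) (comp j) ≫ comp i ≫ str)
  disjoint (i j : Fin n) (h : i.val + 1 < j.val) :
    Disjoint (Set.range (comp i)) (Set.range (comp j))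

/-- A `ℂ`-point `p` of the chain that lies on the component `R_i` and on no other component;
these are the points of `R_i` at which `R` is smooth. -/
structure Chain.IsSmoothPointOn {n : ℕ} (C : Chain n) (p : Spec (.of ℂ) ⟶ C.R) (i : Fin n) :
    Prop where
  isOver : p ≫ C.str = 𝟙 _
  factors : ∃ a : Spec (.of ℂ) ⟶ P1, a ≫ C.comp i = p
  smooth (j : Fin n) (h : j ≠ i) : Disjoint (Set.range p) (Set.range (C.comp j))

/-- `L 0, …, L (n - 1)` are line bundles on the chain, and `L i` is `𝒪(1)` on the component `R_i`
and `𝒪` on every other component. -/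
def Chain.IsStandardFamily {n : ℕ} (C : Chain n) (L : Fin n → C.R.Modules) : Prop :=
  ∀ i, IsLineBundle (L i) ∧
    ∀ j, IsTwist ((Scheme.Modules.pullback (C.comp j)).obj (L i)) (if i = j then 1 else 0)

/-! ### Fibres, flags and their stabilizers -/

/-- The fibre at a `ℂ`-point, as a functor from `𝒪_X`-modules to complex vector spaces:
`M ↦ Γ(Spec ℂ, p^* M)`. -/
def fiber {X : Scheme.{0}} (p : Spec (.of ℂ) ⟶ X) : X.Modules ⥤ ModuleCat.{0} ℂ :=
  Scheme.Modules.pullback p ⋙ moduleSpecΓFunctor (R := .of ℂ)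

/-- Evaluation of automorphisms at two points:
`Aut(E) → Aut(E_p) × Aut(E_q)`. -/
def eval {X : Scheme.{0}} (E : X.Modules) (p q : Spec (.of ℂ) ⟶ X) :
    Aut E →* Aut ((fiber p).obj E) × Aut ((fiber q).obj E) :=
  ((fiber p).mapAut E).prod ((fiber q).mapAut E)

/-- The subgroup of linear automorphisms of `V` that stabilize every member of a family of
subspaces. -/
def stabilizer {V : ModuleCat.{0} ℂ} {ι : Type} (F : ι → Submodule ℂ V) : Subgroup (Aut V) where
  carrier := {b | ∀ k, (F k).map b.hom.hom = F k}
  mul_mem' {a b} ha hb k := by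
    have : (a * b).hom.hom = a.hom.hom ∘ₗ b.hom.hom := rfl
    rw [this, Submodule.map_comp, hb k, ha k]
  one_mem' k := by
    have : (1 : Aut V).hom.hom = LinearMap.id := rfl
    rw [this, Submodule.map_id]
  inv_mem' {a} ha k := by
    have : (a⁻¹).hom.hom ∘ₗ a.hom.hom = LinearMap.id := by
      have h : a.hom ≫ a.inv = 𝟙 V := a.hom_inv_id
      exact congrArg ModuleCat.Hom.hom h
    conv_lhs => rw [← ha k]
    rw [← Submodule.map_comp, this, Submodule.map_id]

section Decomposition

/-! A direct sum decomposition `E = L_0 ⊕ ⋯ ⊕ L_{n-1}` is a bicone `D` (an object `E = D.pt` with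
inclusions `D.ι i : L i ⟶ E` and projections `D.π i : E ⟶ L i`) that is a biproduct. -/

variable {X : Scheme.{0}} {n : ℕ} {L : Fin n → X.Modules}
  (D : Limits.Bicone L) (p : Spec (.of ℂ) ⟶ X)

/-- The line `L_{i,p}` in the fibre `E_p`. -/
def line (i : Fin n) : Submodule ℂ ((fiber p).obj D.pt) :=
  LinearMap.range ((fiber p).map (D.ι i)).hom

/-- `B⁺`: the stabilizer of the flag with members `⨁_{i ≤ k} L_{i,p}` in `E_p`. -/
def borelPlus : Subgroup (Aut ((fiber p).obj D.pt)) :=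
  stabilizer fun k : Fin n => ⨆ i ≤ k, line D p i

/-- `B⁻`: the stabilizer of the flag with members `⨁_{i ≥ k} L_{i,p}` in `E_p`. -/
def borelMinus : Subgroup (Aut ((fiber p).obj D.pt)) :=
  stabilizer fun k : Fin n => ⨆ i ≥ k, line D p i

/-- The homomorphism `π` from a subgroup `B` of `Aut(E_p)` to the torus `T = ∏ Aut(L_i)` is the
projection to the torus part: for every `b ∈ B` and every `i`, the diagonal component
`L_{i,p} → E_p → E_p → L_{i,p}` of `b` is the value at `p` of the automorphism `π(b)_i` of
`L_i`. -/
def IsTorusProjection (B : Subgroup (Aut ((fiber p).obj D.pt))) (π : B →* (∀ i, Aut (L i))) : Prop :=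
  ∀ (b : B) (i : Fin n),
    (fiber p).map (D.ι i) ≫ (b : Aut ((fiber p).obj D.pt)).hom ≫ (fiber p).map (D.π i) =
      (fiber p).map (π b i).hom

end Decomposition

end GiesekerChain

end

/-! An endomorphism of the direct sum is a matrix with entries in `Hom(L i, L j)`, so everything
follows from computing these spaces together with their evaluations at `p` and `q`.

Let `i < j`. On `R_i` an entry is a map `𝒪(1) ⟶ 𝒪`, hence zero. On every other component to the left
of `R_j` it is a map `𝒪 ⟶ 𝒪`, hence constant, and the nodes carry the vanishing along; so the entry
is zero left of `R_j`, in particular at `p`. On `R_j` it is a section of `𝒪(1)` vanishing at the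
left node, so it is unique up to a scalar and has no other zero. To the right it continues by
constants, uniquely and without zeros. Hence evaluation at `q` identifies `Hom(L i, L j)` with
`Hom(L_{i,q}, L_{j,q})`. For `i > j` the mirror image holds, with `p` and `q` exchanged. For `i = j`
an endomorphism is constant on each component, so it is a scalar and is determined by its value at
either point. These facts are collected in `IsTriangular` and proved in
`Chain.IsStandardFamily.isTriangular`.

The rest is linear algebra. The stabilizers of the two flags are the two opposite groups of
triangular matrices. An endomorphism is therefore the same as a triangular matrix at `p` and an
oppositely triangular one at `q` whose diagonals come from the same endomorphisms of the `L i`. This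
gives injectivity, the torus projections and the description of the image.

The geometric input has two halves. Morphisms between twists on the projective line are polynomials
of bounded degree (`exists_coeffs`). Morphisms on the components that agree at the nodes glue
(`Chain.exists_hom_of_compatible`), because `R` is reduced and consecutive components meet in a
reduced point. -/

open CategoryTheory AlgebraicGeometry

noncomputable section

namespace GiesekerChain

open Scheme.Modules

/-! ### Pullback of sections of modules, and stability of frames under pullback. -/

section Sections

variable {X Y Z : Scheme.{0}}

/-- The pullback `φ^* s` of a section `s` of an `𝒪_Y`-module along `φ : X ⟶ Y`. -/
def secPullback (φ : X ⟶ Y) {M : Y.Modules} {U : Y.Opens} (s : Γ(M, U)) :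
    Γ((Scheme.Modules.pullback φ).obj M, φ ⁻¹ᵁ U) :=
  ((pullbackPushforwardAdjunction φ).unit.app M).app U s

lemma hom_app_map {M N : X.Modules} (f : M ⟶ N) {U V : X.Opens} (h : V ≤ U) (s : Γ(M, U)) :
    f.app V (M.presheaf.map (homOfLE h).op s) = N.presheaf.map (homOfLE h).op (f.app U s) :=
  congr($(f.mapPresheaf.naturality (homOfLE h).op) s)

lemma secPullback_map (φ : X ⟶ Y) {M : Y.Modules} {U V : Y.Opens} (h : V ≤ U) (s : Γ(M, U)) :
    secPullback φ (M.presheaf.map (homOfLE h).op s : Γ(M, V)) =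
      ((Scheme.Modules.pullback φ).obj M).presheaf.map
        (homOfLE (φ.preimage_mono h)).op (secPullback φ s) :=
  hom_app_map _ h s

lemma secPullback_smul (φ : X ⟶ Y) {M : Y.Modules} {U : Y.Opens} (a : Γ(Y, U)) (s : Γ(M, U)) :
    secPullback φ (a • s) = (φ.app U a) • secPullback φ s :=
  Hom.app_smul _ a s

lemma pullback_map_secPullback (φ : X ⟶ Y) {M N : Y.Modules} (f : M ⟶ N) {U : Y.Opens}
    (s : Γ(M, U)) :
    ((Scheme.Modules.pullback φ).map f).app (φ ⁻¹ᵁ U) (secPullback φ s) =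
      secPullback φ (f.app U s) := by
  have := (pullbackPushforwardAdjunction φ).unit.naturality f
  exact congr(Scheme.Modules.Hom.app $this U s).symm

/-- `pullbackComp` is the conjugate of the identification of pushforwards under the adjunctions, so
it respects units, and `secPullback` is given by a unit. -/
lemma pullbackComp_secPullback (φ : X ⟶ Y) (ψ : Y ⟶ Z) {M : Z.Modules} {U : Z.Opens}
    (s : Γ(M, U)) :
    ((pullbackComp φ ψ).hom.app M).app (φ ⁻¹ᵁ (ψ ⁻¹ᵁ U)) (secPullback φ (secPullback ψ s)) =
      secPullback (φ ≫ ψ) s := by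
  have h := conjugateEquiv_pullbackComp_inv φ ψ
  have h2 := unit_conjugateEquiv ((pullbackPushforwardAdjunction ψ).comp
    (pullbackPushforwardAdjunction φ)) (pullbackPushforwardAdjunction (φ ≫ ψ))
    (pullbackComp φ ψ).inv M
  rw [h] at h2
  have h3 : secPullback φ (secPullback ψ s) =
      ((pullbackComp φ ψ).inv.app M).app _ (secPullback (φ ≫ ψ) s) :=
    congr(Scheme.Modules.Hom.app $h2 U s)
  rw [h3]
  exact congr(Scheme.Modules.Hom.app $((pullbackComp φ ψ).inv_hom_id_app M) _ _)

/-- By adjunction a morphism out of `φ^* M` is determined by its adjoint, whose values are exactly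
those on pulled-back sections. -/
lemma eq_zero_of_secPullback (φ : X ⟶ Y) {M : Y.Modules} {N : X.Modules}
    (g : (Scheme.Modules.pullback φ).obj M ⟶ N)
    (h : ∀ (U : Y.Opens) (s : Γ(M, U)), g.app (φ ⁻¹ᵁ U) (secPullback φ s) = 0) : g = 0 := by
  apply ((pullbackPushforwardAdjunction φ).homEquiv M N).injective
  apply Scheme.Modules.hom_ext
  intro U
  ext s
  simp only [Adjunction.homEquiv_unit, Functor.map_zero, Limits.comp_zero]
  exact h U s

/-! ### Frames -/

lemma IsFrame.restrict {M : X.Modules} {U : X.Opens} {e : Γ(M, U)} (he : IsFrame M U e)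
    {V : X.Opens} (h : V ≤ U) : IsFrame M V (M.presheaf.map (homOfLE h).op e) := by
  intro W hW
  have := he W (hW.trans h)
  rw [← ConcreteCategory.comp_apply, ← Functor.map_comp]
  exact this

lemma IsFrame.map_iso {M N : X.Modules} (f : M ⟶ N) [IsIso f] {U : X.Opens} {e : Γ(M, U)}
    (he : IsFrame M U e) : IsFrame N U (f.app U e) := by
  intro V hV
  have h1 : Function.Bijective (f.app V) := ConcreteCategory.bijective_of_isIso (f.app V)
  have h2 := h1.comp (he V hV)
  convert h2 using 2 with a
  simp [hom_app_map]

/-- The section `1` of the structure sheaf, as a module. -/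
abbrev unitModule (X : Scheme.{0}) : X.Modules := SheafOfModules.unit X.ringCatSheaf

def unitOne (X : Scheme.{0}) (U : X.Opens) : Γ(unitModule X, U) := (1 : Γ(X, U))

lemma unitOne_map {U V : X.Opens} (h : V ≤ U) :
    (unitModule X).presheaf.map (homOfLE h).op (unitOne X U) = unitOne X V :=
  map_one (X.presheaf.map (homOfLE h).op).hom

/-- A morphism of `𝒪_X`-modules from compatible linear maps on sections. -/
def homMk {M N : X.Modules} (f : ∀ U : X.Opens, Γ(M, U) → Γ(N, U))
    (hadd : ∀ U (s t : Γ(M, U)), f U (s + t) = f U s + f U t)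
    (hsmul : ∀ U (a : Γ(X, U)) (s : Γ(M, U)), f U (a • s) = a • f U s)
    (hmap : ∀ (U V : X.Opens) (h : V ≤ U) (s : Γ(M, U)),
      f V (M.presheaf.map (homOfLE h).op s) = N.presheaf.map (homOfLE h).op (f U s)) : M ⟶ N :=
  SheafOfModules.Hom.mk
    { app U := ModuleCat.ofHom (X := M.val.obj U) (Y := N.val.obj U)
        { toFun := f U.unop, map_add' := hadd U.unop, map_smul' := hsmul U.unop }
      naturality {U V} i := by
        ext s
        exact hmap U.unop V.unop i.unop.le s }

lemma presheaf_map_self (M : X.Modules) {U : X.Opens} (s : Γ(M, U)) (h : U ≤ U) :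
    M.presheaf.map (homOfLE h).op s = s :=
  congr($(M.presheaf.map_id (.op U)) s)

lemma presheaf_map_map (M : X.Modules) {U V W : X.Opens} (h : V ≤ U) (h' : W ≤ V) (s : Γ(M, U)) :
    M.presheaf.map (homOfLE h').op (M.presheaf.map (homOfLE h).op s) =
      M.presheaf.map (homOfLE (h'.trans h)).op s := by
  rw [← ConcreteCategory.comp_apply, ← Functor.map_comp]
  rfl

/-- A global section defines a morphism from the structure sheaf. -/
def homOfSection {M : X.Modules} (s : Γ(M, ⊤)) : unitModule X ⟶ M :=
  homMk (fun U (a : Γ(X, U)) => a • M.presheaf.map (homOfLE le_top).op s)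
    (fun U a b => add_smul (R := Γ(X, U)) a b _) (fun U a b => mul_smul (α := Γ(X, U)) a b _)
    (fun U V h a => by
      have h1 := Scheme.Modules.map_smul M (homOfLE h) (a : Γ(X, U))
        (M.presheaf.map (homOfLE le_top).op s)
      rw [presheaf_map_map] at h1
      exact h1.symm)

lemma homOfSection_unitOne {M : X.Modules} (s : Γ(M, ⊤)) (U : X.Opens) :
    (homOfSection s).app U (unitOne X U) = M.presheaf.map (homOfLE le_top).op s :=
  one_smul Γ(X, U) _

lemma unit_hom_ext {M : X.Modules} {f g : unitModule X ⟶ M}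
    (h : f.app ⊤ (unitOne X ⊤) = g.app ⊤ (unitOne X ⊤)) : f = g := by
  apply Scheme.Modules.hom_ext
  intro U
  ext (a : Γ(X, U))
  have ha : (a : Γ(unitModule X, U)) = a • (unitModule X).presheaf.map
      (homOfLE (le_top : U ≤ ⊤)).op (unitOne X ⊤) := by
    rw [unitOne_map]
    exact (mul_one a).symm
  rw [ha, Hom.app_smul, Hom.app_smul, hom_app_map, hom_app_map, h]

lemma isIso_homOfSection {M : X.Modules} {s : Γ(M, ⊤)} (hs : IsFrame M ⊤ s) :
    IsIso (homOfSection s) := by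
  rw [Hom.isIso_iff_isIso_app]
  intro U
  rw [ConcreteCategory.isIso_iff_bijective]
  exact hs U le_top

lemma isFrame_top_of_isIso {M : X.Modules} {s : Γ(M, ⊤)} (h : IsIso (homOfSection s)) :
    IsFrame M ⊤ s := by
  intro U hU
  rw [Hom.isIso_iff_isIso_app] at h
  exact ConcreteCategory.bijective_of_isIso ((homOfSection s).app U)

/-- The pullback of the structure sheaf is the structure sheaf. The inverse of multiplication by
`φ^* s` is produced by adjunction. -/
lemma IsFrame.secPullback_top (φ : X ⟶ Y) {M : Y.Modules} {s : Γ(M, ⊤)} (hs : IsFrame M ⊤ s) :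
    IsFrame ((Scheme.Modules.pullback φ).obj M) ⊤ (secPullback φ s) := by
  have := isIso_homOfSection hs
  let one : Γ((pushforward φ).obj (unitModule X), ⊤) := unitOne X ⊤
  -- `k` takes `s` to `1` in `φ_* 𝒪_X`; its adjoint `r` takes `φ^* s` to `1` and is the required
  -- inverse.
  let k : M ⟶ (pushforward φ).obj (unitModule X) := inv (homOfSection s) ≫ homOfSection one
  let r := ((pullbackPushforwardAdjunction φ).homEquiv _ _).symm k
  have hk (U : Y.Opens) : k.app U (M.presheaf.map (homOfLE le_top).op s) = unitOne X (φ ⁻¹ᵁ U) := by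
    rw [← homOfSection_unitOne]
    have h1 : homOfSection s ≫ k = homOfSection one := by simp [k]
    have h2 := congr(Scheme.Modules.Hom.app $h1 U (unitOne Y U))
    refine h2.trans ?_
    rw [homOfSection_unitOne]
    exact unitOne_map (X := X) (U := ⊤) le_top
  have hr (U : Y.Opens) (m : Γ(M, U)) : r.app (φ ⁻¹ᵁ U) (secPullback φ m) = k.app U m := by
    have h1 : (pullbackPushforwardAdjunction φ).homEquiv _ _ r = k := Equiv.apply_symm_apply _ _
    rw [Adjunction.homEquiv_unit] at h1
    exact congr(Scheme.Modules.Hom.app $h1 U m)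
  obtain ⟨t, ht⟩ : ∃ t : Γ((Scheme.Modules.pullback φ).obj M, ⊤), t = secPullback φ s := ⟨_, rfl⟩
  have htU (U : Y.Opens) : ((Scheme.Modules.pullback φ).obj M).presheaf.map
      (homOfLE (le_top : φ ⁻¹ᵁ U ≤ ⊤)).op t =
        secPullback φ (M.presheaf.map (homOfLE (le_top : U ≤ ⊤)).op s) := by
    rw [ht, secPullback_map]
    rfl
  change IsFrame ((Scheme.Modules.pullback φ).obj M) ⊤ _
  rw [← ht]
  have h1 : homOfSection t ≫ r = 𝟙 _ := by
    apply unit_hom_ext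
    have h3 := homOfSection_unitOne t ⊤
    rw [presheaf_map_self] at h3
    have h4 := hk ⊤
    rw [presheaf_map_self, ← hr] at h4
    exact (congrArg (r.app ⊤) (h3.trans ht)).trans h4
  have h2 : r ≫ homOfSection t = 𝟙 _ := by
    rw [← sub_eq_zero]
    apply eq_zero_of_secPullback
    intro U m
    obtain ⟨a, rfl⟩ := (hs U le_top).2 m
    dsimp only
    have h3 : r.app (φ ⁻¹ᵁ U) (secPullback φ (a • M.presheaf.map (homOfLE le_top).op s)) =
        φ.app U a • unitOne X (φ ⁻¹ᵁ U) := by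
      rw [secPullback_smul, Hom.app_smul, hr, hk]
    have h4 : (homOfSection t).app (φ ⁻¹ᵁ U) (φ.app U a • unitOne X (φ ⁻¹ᵁ U)) =
        secPullback φ (a • M.presheaf.map (homOfLE le_top).op s) := by
      rw [Hom.app_smul, homOfSection_unitOne, secPullback_smul, htU]
    rw [Hom.sub_app]
    refine sub_eq_zero.mpr ?_
    exact (congrArg ((homOfSection t).app (φ ⁻¹ᵁ U)) h3).trans h4
  exact isFrame_top_of_isIso ⟨r, h1, h2⟩

lemma IsFrame.secPullback_of_eq_top (φ : X ⟶ Y) {M : Y.Modules} {U : Y.Opens} (hU : U = ⊤)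
    {s : Γ(M, U)} (hs : IsFrame M U s) :
    IsFrame ((Scheme.Modules.pullback φ).obj M) (φ ⁻¹ᵁ U) (secPullback φ s) := by
  subst hU
  exact hs.secPullback_top φ

/-- Restriction along an open immersion as a pullback, on sections. -/
lemma restrictFunctorIsoPullback_app (φ : X ⟶ Y) [IsOpenImmersion φ] (M : Y.Modules)
    (U : Y.Opens) (s : Γ(M, U)) :
    ((restrictFunctorIsoPullback φ).hom.app M).app (φ ⁻¹ᵁ U)
      ((M.restrictAppIso φ (φ ⁻¹ᵁ U)).inv
        (M.presheaf.map (homOfLE (φ.image_preimage_le U)).op s)) = secPullback φ s := by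
  have h := Adjunction.unit_leftAdjointUniq_hom_app (restrictAdjunction φ)
    (pullbackPushforwardAdjunction φ) M
  exact congr(Scheme.Modules.Hom.app $h U s)

lemma isFrame_map_iso_iff {M N : X.Modules} (f : M ⟶ N) [IsIso f] {U : X.Opens} {e : Γ(M, U)} :
    IsFrame N U (f.app U e) ↔ IsFrame M U e := by
  refine ⟨fun h => ?_, fun h => h.map_iso f⟩
  have := h.map_iso (inv f)
  rwa [Scheme.Modules.inv_app, ← ConcreteCategory.comp_apply, IsIso.hom_inv_id,
    ConcreteCategory.id_apply] at this

/-- The opens of the scheme `U` are the opens of `X` inside `U`, with the same sections. This turns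
a frame over an open subset into a global frame. -/
lemma isFrame_restrict_iff {M : X.Modules} {U : X.Opens} (e : Γ(M, U)) :
    IsFrame (M.restrict U.ι) (U.ι ⁻¹ᵁ U) ((M.restrictAppIso U.ι (U.ι ⁻¹ᵁ U)).inv
        (M.presheaf.map (homOfLE (U.ι.image_preimage_le U)).op e)) ↔ IsFrame M U e := by
  have key (V : (U : Scheme.{0}).Opens) (hV : V ≤ U.ι ⁻¹ᵁ U) (hV' : U.ι ''ᵁ V ≤ U) :
      (Function.Bijective fun f : Γ((U : Scheme.{0}), V) =>
        f • ((M.restrict U.ι).presheaf.map (homOfLE hV).op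
          ((M.restrictAppIso U.ι (U.ι ⁻¹ᵁ U)).inv
            (M.presheaf.map (homOfLE (U.ι.image_preimage_le U)).op e)))) ↔
      Function.Bijective fun f : Γ(X, U.ι ''ᵁ V) => f • M.presheaf.map (homOfLE hV').op e := by
    have h1 : Function.Bijective (M.restrictAppIso U.ι V).hom :=
      ConcreteCategory.bijective_of_isIso _
    have h2 : Function.Bijective (U.ι.appIso V).inv := ConcreteCategory.bijective_of_isIso _
    rw [← Function.Bijective.of_comp_iff' h1, ← Function.Bijective.of_comp_iff _ h2]
    refine iff_of_eq (congrArg Function.Bijective (funext fun f => ?_))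
    exact congrArg ((U.ι.appIso V).inv f • ·)
      (presheaf_map_map M (U.ι.image_preimage_le U) (U.ι.image_mono hV) e)
  constructor
  · intro h W hW
    have h2 : U.ι ''ᵁ (U.ι ⁻¹ᵁ W) = W := by
      rw [Scheme.Hom.image_preimage_eq_opensRange_inf, Scheme.Opens.opensRange_ι]
      exact inf_eq_right.mpr hW
    have h3 := (key _ (U.ι.preimage_mono hW) (h2.trans_le hW)).mp (h _ _)
    have h4 : ∀ (W' : X.Opens) (hW' : W' ≤ U), W' = W →
        (Function.Bijective fun f : Γ(X, W') => f • M.presheaf.map (homOfLE hW').op e) →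
        Function.Bijective fun f : Γ(X, W) => f • M.presheaf.map (homOfLE hW).op e := by
      rintro W' hW' rfl h
      exact h
    exact h4 _ _ h2 h3
  · intro h V hV
    have hV' : U.ι ''ᵁ V ≤ U := U.ι_image_le V
    exact (key V hV hV').mpr (h _ _)

lemma isFrame_secPullback_ι_iff {M : X.Modules} {U : X.Opens} (e : Γ(M, U)) :
    IsFrame ((Scheme.Modules.pullback U.ι).obj M) (U.ι ⁻¹ᵁ U) (secPullback U.ι e) ↔
      IsFrame M U e := by
  rw [← restrictFunctorIsoPullback_app, isFrame_map_iso_iff, isFrame_restrict_iff]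

lemma isFrame_secPullback_comp_iff (φ : X ⟶ Y) (ψ : Y ⟶ Z) {M : Z.Modules} {U : Z.Opens}
    (s : Γ(M, U)) :
    IsFrame ((Scheme.Modules.pullback (φ ≫ ψ)).obj M) ((φ ≫ ψ) ⁻¹ᵁ U) (secPullback (φ ≫ ψ) s) ↔
      IsFrame ((Scheme.Modules.pullback φ).obj ((Scheme.Modules.pullback ψ).obj M))
        (φ ⁻¹ᵁ ψ ⁻¹ᵁ U) (secPullback φ (secPullback ψ s)) := by
  rw [← pullbackComp_secPullback]
  exact isFrame_map_iso_iff ((pullbackComp φ ψ).hom.app M)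

/-- After restricting to `U` the frame is global, so `φ ∣_ U` preserves it. The square formed by `φ
∣_ U` and the two open immersions transports this back to `φ`. -/
lemma IsFrame.secPullback (φ : X ⟶ Y) {M : Y.Modules} {U : Y.Opens} {s : Γ(M, U)}
    (hs : IsFrame M U s) :
    IsFrame ((Scheme.Modules.pullback φ).obj M) (φ ⁻¹ᵁ U) (secPullback φ s) := by
  rw [← isFrame_secPullback_ι_iff] at hs ⊢
  rw [← isFrame_secPullback_comp_iff]
  have h := hs.secPullback_of_eq_top (φ ∣_ U) (by simp)
  rw [← isFrame_secPullback_comp_iff] at h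
  rwa [morphismRestrict_ι] at h

end Sections

/-! ### Values of functions and sections at a `ℂ`-point; fibres of line bundles. -/

section Fibre

variable {X Y : Scheme.{0}}

/-- The point of `X` underlying a `ℂ`-point. -/
def pt (p : Spec (.of ℂ) ⟶ X) : X := p (IsLocalRing.closedPoint ℂ)

lemma eq_closedPoint (x : Spec (.of ℂ)) : x = IsLocalRing.closedPoint ℂ :=
  Subsingleton.elim (α := PrimeSpectrum ℂ) _ _

lemma top_le_preimage {p : Spec (.of ℂ) ⟶ X} {U : X.Opens} (h : pt p ∈ U) : ⊤ ≤ p ⁻¹ᵁ U := by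
  intro x _
  rw [eq_closedPoint x]
  exact h

/-- The value at a `ℂ`-point of a regular function. -/
def val (p : Spec (.of ℂ) ⟶ X) {U : X.Opens} (h : pt p ∈ U) : Γ(X, U) →+* ℂ :=
  (p.appLE U ⊤ (top_le_preimage h) ≫ (Scheme.ΓSpecIso (.of ℂ)).hom).hom

lemma val_map (p : Spec (.of ℂ) ⟶ X) {U V : X.Opens} (h : pt p ∈ V) (hVU : V ≤ U) (a : Γ(X, U)) :
    val p h (X.presheaf.map (homOfLE hVU).op a) = val p (hVU h) a := by
  have := p.map_appLE (top_le_preimage h) (homOfLE hVU).op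
  exact congr((Scheme.ΓSpecIso (.of ℂ)).hom ($this a))

lemma pt_comp (p : Spec (.of ℂ) ⟶ X) (φ : X ⟶ Y) : pt (p ≫ φ) = φ (pt p) := rfl

lemma val_comp (p : Spec (.of ℂ) ⟶ X) (φ : X ⟶ Y) {U : Y.Opens} (h : pt (p ≫ φ) ∈ U) (a : Γ(Y, U)) :
    val (p ≫ φ) h a = val p (U := φ ⁻¹ᵁ U) h (φ.app U a) := by
  have := Scheme.Hom.comp_appLE p φ U ⊤ (top_le_preimage h)
  exact congr((Scheme.ΓSpecIso (.of ℂ)).hom ($this a))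

/-- The value in the fibre at `p` of a section defined near `p`. -/
def fiberSec (p : Spec (.of ℂ) ⟶ X) {M : X.Modules} {U : X.Opens} (h : pt p ∈ U) (s : Γ(M, U)) :
    (fiber p).obj M :=
  ((Scheme.Modules.pullback p).obj M).presheaf.map (homOfLE (top_le_preimage h)).op
    (secPullback p s)

lemma fiber_map_fiberSec (p : Spec (.of ℂ) ⟶ X) {M N : X.Modules} (f : M ⟶ N) {U : X.Opens}
    (h : pt p ∈ U) (s : Γ(M, U)) :
    (fiber p).map f (fiberSec p h s) = fiberSec p h (f.app U s) := by
  have := hom_app_map ((Scheme.Modules.pullback p).map f) (top_le_preimage h) (secPullback p s)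
  rw [pullback_map_secPullback] at this
  exact this

/-- A global section of a module on `Spec ℂ` as an element of the associated vector space. -/
def ofTop {N : (Spec (.of ℂ)).Modules} (x : Γ(N, ⊤)) : (moduleSpecΓFunctor (R := .of ℂ)).obj N := x

/-- Compares the `ℂ`-vector space structure of a fibre with the module structure over the global
functions of `Spec ℂ`. -/
lemma ΓSpecIso_hom_smul {N : (Spec (.of ℂ)).Modules} (a : Γ(Spec (.of ℂ), ⊤)) (x : Γ(N, ⊤)) :
    (Scheme.ΓSpecIso (.of ℂ)).hom a • ofTop x = ofTop (a • x) := by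
  have h1 : (Scheme.ΓSpecIso (.of ℂ)).inv ((Scheme.ΓSpecIso (.of ℂ)).hom a) = a :=
    congr($((Scheme.ΓSpecIso (.of ℂ)).hom_inv_id) a)
  have h2 := smul_Spec_def (R := .of ℂ) (M := N) (U := ⊤) ((Scheme.ΓSpecIso (.of ℂ)).hom a) x
  rw [h1] at h2
  refine Eq.trans h2 ?_
  have h3 : (Spec (.of ℂ)).presheaf.map (homOfLE (le_top (a := (⊤ : (Spec (.of ℂ)).Opens)))).op a = a :=
    congr($((Spec (.of ℂ)).presheaf.map_id (.op ⊤)) a)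
  exact congrArg (· • x) h3

lemma fiberSec_smul (p : Spec (.of ℂ) ⟶ X) {M : X.Modules} {U : X.Opens}
    (h : pt p ∈ U) (a : Γ(X, U)) (s : Γ(M, U)) :
    fiberSec p h (a • s) = val p h a • fiberSec p h s := by
  have h1 : fiberSec p h (a • s) = (p.appLE U ⊤ (top_le_preimage h) a •
      (((Scheme.Modules.pullback p).obj M).presheaf.map (homOfLE (top_le_preimage h)).op
        (secPullback p s) : Γ((Scheme.Modules.pullback p).obj M, ⊤)) :
          Γ((Scheme.Modules.pullback p).obj M, ⊤)) := by
    rw [fiberSec, secPullback_smul, Scheme.Modules.map_smul]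
    rfl
  rw [h1]
  exact (ΓSpecIso_hom_smul _ _).symm

/-- The pulled-back frame is a frame over the one-point scheme `Spec ℂ`, so its value is a basis of
the fibre. -/
lemma IsFrame.fiberSec_bijective (p : Spec (.of ℂ) ⟶ X) {M : X.Modules} {U : X.Opens}
    (h : pt p ∈ U) {e : Γ(M, U)} (he : IsFrame M U e) :
    Function.Bijective fun c : ℂ => c • fiberSec p h e := by
  have h1 := (he.secPullback p) ⊤ (top_le_preimage h)
  have h2 : Function.Bijective (Scheme.ΓSpecIso (.of ℂ)).hom :=
    ConcreteCategory.bijective_of_isIso _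
  rw [← Function.Bijective.of_comp_iff _ h2]
  refine (congrArg Function.Bijective (funext fun a => ?_)).mpr h1
  exact ΓSpecIso_hom_smul a _

instance (p : Spec (.of ℂ) ⟶ X) : (fiber p).Additive where
  map_add {M N f g} := by
    have h : (Scheme.Modules.pullback p).map (f + g) = _ := Functor.map_add _
    ext x
    exact congr(Scheme.Modules.Hom.app $h ⊤ x)

/-- The fibre at a composition. -/
def fiberComp (p : Spec (.of ℂ) ⟶ X) (φ : X ⟶ Y) :
    Scheme.Modules.pullback φ ⋙ fiber p ≅ fiber (p ≫ φ) :=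
  (Functor.associator _ _ _).symm ≪≫ Functor.isoWhiskerRight (pullbackComp p φ) _

lemma fiberComp_fiberSec (p : Spec (.of ℂ) ⟶ X) (φ : X ⟶ Y) {M : Y.Modules} {U : Y.Opens}
    (h : pt (p ≫ φ) ∈ U) (s : Γ(M, U)) :
    (fiberComp p φ).hom.app M (fiberSec p (U := φ ⁻¹ᵁ U) h (secPullback φ s)) =
      fiberSec (p ≫ φ) h s := by
  have h1 := hom_app_map ((pullbackComp p φ).hom.app M) (top_le_preimage (p := p) (U := φ ⁻¹ᵁ U) h)
    (secPullback p (secPullback φ s))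
  rw [pullbackComp_secPullback] at h1
  refine Eq.trans ?_ h1
  have h2 : (fiberComp p φ).hom.app M =
      (moduleSpecΓFunctor (R := .of ℂ)).map ((pullbackComp p φ).hom.app M) := by
    exact Category.id_comp _
  rw [h2]
  rfl

end Fibre

/-! ### Functions on the standard charts of the projective line, and its `ℂ`-points. -/

section ProjectiveLine

open HomogeneousLocalization

lemma IsHomogeneous.aeval_mul {σ R A : Type*} [CommSemiring R] [CommSemiring A] [Algebra R A]
    {a : MvPolynomial σ R} {n : ℕ} (ha : a.IsHomogeneous n) (u : A) (v : σ → A) :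
    MvPolynomial.aeval (fun k => u * v k) a = u ^ n * MvPolynomial.aeval v a := by
  rw [MvPolynomial.aeval_def, MvPolynomial.aeval_def, MvPolynomial.eval₂_eq, MvPolynomial.eval₂_eq,
    Finset.mul_sum]
  refine Finset.sum_congr rfl fun d hd => ?_
  have h := ha (MvPolynomial.mem_support_iff.mp hd)
  have h2 : ∑ i ∈ d.support, d i = n := by
    rw [← h, Finsupp.weight_apply]
    simp [Finsupp.sum]
  simp only [mul_pow, Finset.prod_mul_distrib, Finset.prod_pow_eq_pow_sum, h2]
  ring

/-- Constants in the degree zero part of a localization of `ℂ[x₀, x₁]`. -/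
def awayConst (f : MvPolynomial (Fin 2) ℂ) : ℂ →+* Away grading f :=
  (fromZeroRingHom grading _).comp (algebraMap ℂ (grading 0))

lemma val_awayConst (f : MvPolynomial (Fin 2) ℂ) (c : ℂ) :
    (awayConst f c).val = algebraMap ℂ (Localization.Away f) c := by
  rw [IsScalarTower.algebraMap_apply ℂ (MvPolynomial (Fin 2) ℂ)]
  exact Localization.mk_one_eq_algebraMap _

lemma X_mem (i : Fin 2) : (MvPolynomial.X i : MvPolynomial (Fin 2) ℂ) ∈ grading 1 :=
  MvPolynomial.isHomogeneous_X ℂ i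

/-- The fraction `x_j / x_i`. -/
def awayRatio (i j : Fin 2) : Away grading (MvPolynomial.X i : MvPolynomial (Fin 2) ℂ) :=
  HomogeneousLocalization.Away.mk grading (X_mem i) 1 (MvPolynomial.X j) (X_mem j)

/-- Dehomogenization: `a / x_i ^ n` with `a` homogeneous of degree `n` equals `f (x_j / x_i)`, where
`f` arises from `a` by putting `x_i = 1` and `x_j = X`. -/
lemma exists_eval₂_awayRatio {i j : Fin 2} (hij : i ≠ j)
    (z : Away grading (MvPolynomial.X i : MvPolynomial (Fin 2) ℂ)) :
    ∃ f : Polynomial ℂ, z = f.eval₂ (awayConst _) (awayRatio i j) := by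
  obtain ⟨n, a, ha, rfl⟩ := Away.mk_surjective grading (X_mem i) z
  let f : Polynomial ℂ := MvPolynomial.aeval (fun k => if k = i then 1 else Polynomial.X) a
  refine ⟨f, ?_⟩
  apply HomogeneousLocalization.val_injective
  let Loc := Localization.Away (MvPolynomial.X i : MvPolynomial (Fin 2) ℂ)
  let u : Loc := Localization.mk 1 ⟨MvPolynomial.X i, Submonoid.mem_powers _⟩
  have hu : algebraMap (MvPolynomial (Fin 2) ℂ) Loc (MvPolynomial.X i) * u = 1 := by
    rw [← Localization.mk_one_eq_algebraMap, Localization.mk_mul]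
    simp only [mul_one, one_mul]
    exact Localization.mk_self ⟨MvPolynomial.X i, Submonoid.mem_powers _⟩
  have hw : (awayRatio i j).val = u * algebraMap (MvPolynomial (Fin 2) ℂ) Loc (MvPolynomial.X j) := by
    rw [← Localization.mk_one_eq_algebraMap, Localization.mk_mul]
    simp [awayRatio]
  have h1 : (f.eval₂ (awayConst _) (awayRatio i j)).val =
      Polynomial.aeval (u * algebraMap (MvPolynomial (Fin 2) ℂ) Loc (MvPolynomial.X j)) f := by
    change algebraMap (Away grading (MvPolynomial.X i : MvPolynomial (Fin 2) ℂ))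
      (Localization.Away (MvPolynomial.X i : MvPolynomial (Fin 2) ℂ)) _ = _
    rw [Polynomial.hom_eval₂, ← hw, Polynomial.aeval_def]
    congr 1
  rw [h1]
  have h2 : Polynomial.aeval (u * algebraMap (MvPolynomial (Fin 2) ℂ) Loc (MvPolynomial.X j)) f =
      MvPolynomial.aeval (fun k => u * algebraMap (MvPolynomial (Fin 2) ℂ) Loc (MvPolynomial.X k)) a := by
    simp only [f]
    rw [← AlgHom.comp_apply, MvPolynomial.comp_aeval]
    congr 2
    funext k
    split_ifs with hk
    · subst hk
      rw [map_one, mul_comm, hu]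
    · have : k = j := by omega
      rw [Polynomial.aeval_X, this]
  have ha' : a.IsHomogeneous n := by simpa using ha
  rw [h2, IsHomogeneous.aeval_mul ha', Away.val_mk]
  have h3 : MvPolynomial.aeval (fun k => algebraMap (MvPolynomial (Fin 2) ℂ) Loc (MvPolynomial.X k)) a =
      algebraMap _ Loc a := by
    have : (MvPolynomial.aeval (fun k => algebraMap (MvPolynomial (Fin 2) ℂ) Loc (MvPolynomial.X k))) =
      (IsScalarTower.toAlgHom ℂ (MvPolynomial (Fin 2) ℂ) Loc) := by
      ext k
      simp
    rw [this]
    rfl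
  rw [h3, ← Localization.mk_one_eq_algebraMap, Localization.mk_pow, Localization.mk_mul]
  simp

lemma isUnit_aeval_X_mul_X : IsUnit ((MvPolynomial.aeval ![1, RatFunc.X] :
    MvPolynomial (Fin 2) ℂ →ₐ[ℂ] RatFunc ℂ).toRingHom (MvPolynomial.X 0 * MvPolynomial.X 1)) := by
  simp [RatFunc.X_ne_zero]

/-- The morphism sending `x₀ ↦ 1` and `x₁ ↦ X`. -/
def awayToRatFunc : Away grading
    (MvPolynomial.X 0 * MvPolynomial.X 1 : MvPolynomial (Fin 2) ℂ) →+* RatFunc ℂ :=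
  (Localization.awayLift (MvPolynomial.aeval ![1, RatFunc.X] :
      MvPolynomial (Fin 2) ℂ →ₐ[ℂ] RatFunc ℂ).toRingHom (MvPolynomial.X 0 * MvPolynomial.X 1)
    isUnit_aeval_X_mul_X).comp (algebraMap _ _)

lemma awayToRatFunc_awayConst (c : ℂ) : awayToRatFunc (awayConst _ c) = RatFunc.C c := by
  have h := val_awayConst (MvPolynomial.X 0 * MvPolynomial.X 1 : MvPolynomial (Fin 2) ℂ) c
  rw [IsScalarTower.algebraMap_apply ℂ (MvPolynomial (Fin 2) ℂ)] at h
  change Localization.awayLift _ _ isUnit_aeval_X_mul_X (awayConst _ c).val = _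
  rw [h]
  refine (IsLocalization.lift_eq _ _).trans ?_
  simp

lemma val_awayMap_awayRatio {i j : Fin 2} (h) :
    (awayMap grading (X_mem j) h (awayRatio i j)).val =
      Localization.mk (MvPolynomial.X j * MvPolynomial.X j)
        ⟨(MvPolynomial.X 0 * MvPolynomial.X 1 : MvPolynomial (Fin 2) ℂ), Submonoid.mem_powers _⟩ := by
  refine (val_awayMap_mk _ _ _ _ _ _ _).trans ?_
  simp

lemma awayToRatFunc_awayMap : awayToRatFunc (awayMap grading (X_mem 1)
    rfl (awayRatio 0 1)) = RatFunc.X := by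
  change Localization.awayLift _ _ isUnit_aeval_X_mul_X (HomogeneousLocalization.val _) = _
  rw [val_awayMap_awayRatio, Localization.mk_eq_mk']
  refine (IsLocalization.lift_mk'_spec _ _ _ _).mpr ?_
  simp

lemma awayMap_awayRatio_mul : awayMap grading (X_mem 1)
    rfl (awayRatio 0 1) * awayMap grading (X_mem 0) (mul_comm _ _)
      (awayRatio 1 0) = 1 := by
  apply HomogeneousLocalization.val_injective
  rw [HomogeneousLocalization.val_mul, val_awayMap_awayRatio, val_awayMap_awayRatio,
    Localization.mk_mul, HomogeneousLocalization.val_one, ← Localization.mk_one]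
  refine Localization.mk_eq_mk_iff.mpr (Localization.r_iff_exists.mpr ⟨1, ?_⟩)
  simp
  ring

/-! ### Constants and coordinates -/

variable {X Y : Scheme.{0}}

lemma res_res {U V W : X.Opens} (h : V ≤ U) (h' : W ≤ V) (a : Γ(X, U)) :
    X.presheaf.map (homOfLE h').op (X.presheaf.map (homOfLE h).op a) =
      X.presheaf.map (homOfLE (h'.trans h)).op a := by
  rw [← ConcreteCategory.comp_apply, ← Functor.map_comp]
  rfl

/-- Constant functions on a scheme over `ℂ`. -/
def const (str : X ⟶ Spec (.of ℂ)) (U : X.Opens) : ℂ →+* Γ(X, U) :=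
  ((Scheme.ΓSpecIso (.of ℂ)).inv ≫ str.appLE ⊤ U le_top).hom

lemma const_top (str : X ⟶ Spec (.of ℂ)) (c : ℂ) :
    const str ⊤ c = str.appTop ((Scheme.ΓSpecIso (.of ℂ)).inv c) :=
  congr($(str.appLE_eq_app (U := ⊤)) ((Scheme.ΓSpecIso (.of ℂ)).inv c))

lemma map_const (str : X ⟶ Spec (.of ℂ)) {U V : X.Opens} (h : V ≤ U) (c : ℂ) :
    X.presheaf.map (homOfLE h).op (const str U c) = const str V c := by
  have := str.appLE_map (U := ⊤) (V := U) le_top (homOfLE h).op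
  exact congr($this ((Scheme.ΓSpecIso (.of ℂ)).inv c))

lemma val_const {p : Spec (.of ℂ) ⟶ X} {str : X ⟶ Spec (.of ℂ)} (hp : p ≫ str = 𝟙 _)
    {U : X.Opens} (h : pt p ∈ U) (c : ℂ) : val p h (const str U c) = c := by
  have h1 := Scheme.Hom.appLE_comp_appLE p str ⊤ U ⊤ le_top (top_le_preimage h)
  have h2 : (𝟙 (Spec (.of ℂ)) : Spec (.of ℂ) ⟶ _).appLE ⊤ ⊤ le_top = 𝟙 _ := by
    exact (Scheme.Hom.appLE_eq_app _).trans (Scheme.Hom.id_app _)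
  rw [hp, h2] at h1
  refine Eq.trans (congr((Scheme.ΓSpecIso (.of ℂ)).hom ($h1 ((Scheme.ΓSpecIso (.of ℂ)).inv c)))) ?_
  exact congr($((Scheme.ΓSpecIso (.of ℂ)).inv_hom_id) c)

/-- The regular function `x_j / x_i` on `D₊(x_i)`. -/
def ratio (i j : Fin 2) : Γ(P1, P1.chart i) :=
  Proj.awayToSection grading (MvPolynomial.X i) (awayRatio i j)

lemma ι_comp_str (i : Fin 2) : (P1.chart i).ι ≫ P1.str =
    Proj.basicOpenToSpec grading (MvPolynomial.X i) ≫ Spec.map (CommRingCat.ofHom (awayConst _)) := by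
  have h := Proj.awayι_toSpecZero grading (MvPolynomial.X i) (X_mem i) one_pos
  rw [Proj.awayι, Category.assoc, Iso.inv_comp_eq, Proj.basicOpenIsoSpec_hom] at h
  rw [P1.str, reassoc_of% h, ← Spec.map_comp]
  rfl

/-- The constants of the graded ring and those coming from the structure morphism agree; this is
what makes polynomial expressions on the charts linear over the base. -/
lemma awayToSection_awayConst (i : Fin 2) (c : ℂ) :
    Proj.awayToSection grading (MvPolynomial.X i) (awayConst _ c) =
      const P1.str (P1.chart i) c := by
  have h1 : const ((P1.chart i).ι ≫ P1.str) ⊤ c =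
      (P1.chart i).topIso.inv (const P1.str (P1.chart i) c) := by
    have h2 := Scheme.Hom.appLE_comp_appLE (P1.chart i).ι P1.str ⊤ (P1.chart i) ⊤ le_top (by simp)
    rw [Scheme.Opens.ι_appLE] at h2
    exact congr($h2 ((Scheme.ΓSpecIso (.of ℂ)).inv c)).symm
  have h3 : const ((P1.chart i).ι ≫ P1.str) ⊤ c = (P1.chart i).topIso.inv
      (Proj.awayToSection grading (MvPolynomial.X i) (awayConst _ c)) := by
    rw [ι_comp_str]
    have h4 := Scheme.Hom.comp_appTop (Proj.basicOpenToSpec grading (MvPolynomial.X i))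
      (Spec.map (CommRingCat.ofHom (awayConst (MvPolynomial.X i))))
    have h5 := Scheme.ΓSpecIso_inv_naturality
      (CommRingCat.ofHom (awayConst (MvPolynomial.X i)))
    have h6 := Proj.basicOpenToSpec_app_top grading (MvPolynomial.X i)
    have h7 : (Scheme.ΓSpecIso (.of ℂ)).inv ≫ (Proj.basicOpenToSpec grading (MvPolynomial.X i) ≫
      Spec.map (CommRingCat.ofHom (awayConst (MvPolynomial.X i)))).appTop =
        CommRingCat.ofHom (awayConst (MvPolynomial.X i)) ≫ 
          Proj.awayToSection grading (MvPolynomial.X i) ≫ (P1.chart i).topIso.inv := by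
      rw [h4, ← reassoc_of% h5]
      congr 1
      rw [Scheme.Hom.appTop, h6, Iso.inv_hom_id_assoc]
    rw [const_top]
    exact congr($h7 c)
  exact (ConcreteCategory.bijective_of_isIso (P1.chart i).topIso.inv).1 (h3.symm.trans h1)

lemma exists_eval₂_ratio {i j : Fin 2} (hij : i ≠ j) (α : Γ(P1, P1.chart i)) :
    ∃ f : Polynomial ℂ, α = f.eval₂ (const P1.str (P1.chart i)) (ratio i j) := by
  have : IsIso (Proj.awayToSection grading (MvPolynomial.X i)) :=
    inferInstanceAs (IsIso (Proj.basicOpenIsoAway grading (MvPolynomial.X i) (X_mem i) one_pos).hom)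
  obtain ⟨z, rfl⟩ := (ConcreteCategory.bijective_of_isIso
    (Proj.awayToSection grading (MvPolynomial.X i))).2 α
  obtain ⟨f, rfl⟩ := exists_eval₂_awayRatio hij z
  refine ⟨f, ?_⟩
  refine (Polynomial.hom_eval₂ _ _ _ _).trans ?_
  congr 1
  ext c
  exact awayToSection_awayConst i c

/-- The restriction of `x₁ / x₀` to the intersection of the charts. -/
def P1.t : Γ(P1, P1.chart 0 ⊓ P1.chart 1) :=
  P1.presheaf.map (homOfLE (inf_le_left : P1.chart 0 ⊓ P1.chart 1 ≤ P1.chart 0)).op (ratio 0 1)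

/-- The restriction of `x₀ / x₁` to the intersection of the charts. -/
def P1.s : Γ(P1, P1.chart 0 ⊓ P1.chart 1) :=
  P1.presheaf.map (homOfLE (inf_le_right : P1.chart 0 ⊓ P1.chart 1 ≤ P1.chart 1)).op (ratio 1 0)

lemma chart_inf : P1.chart 0 ⊓ P1.chart 1 =
    Proj.basicOpen grading (MvPolynomial.X 0 * MvPolynomial.X 1) :=
  (Proj.basicOpen_mul ..).symm

lemma res_awayToSection {i j : Fin 2} (h : MvPolynomial.X 0 * MvPolynomial.X 1 =
      (MvPolynomial.X i * MvPolynomial.X j : MvPolynomial (Fin 2) ℂ))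
    (hi : P1.chart 0 ⊓ P1.chart 1 ≤ P1.chart i)
    (z : Away grading (MvPolynomial.X i : MvPolynomial (Fin 2) ℂ)) :
    P1.presheaf.map (homOfLE hi).op (Proj.awayToSection grading (MvPolynomial.X i) z) =
      P1.presheaf.map (homOfLE chart_inf.le).op (Proj.awayToSection grading _
        (awayMap grading (X_mem j) h z)) := by
  have h1 := Proj.awayMap_awayToSection grading (X_mem j) h
  have h2 := congr(P1.presheaf.map (homOfLE chart_inf.le).op ($h1 z))
  refine Eq.trans ?_ h2.symm
  exact (res_res _ _ _).symm

lemma P1.t_mul_s : P1.t * P1.s = 1 := by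
  have h1 : P1.t = _ := res_awayToSection (i := 0) (j := 1) rfl inf_le_left _
  have h2 : P1.s = _ := res_awayToSection (i := 1) (j := 0) (mul_comm _ _) inf_le_right _
  rw [h1, h2, ← map_mul, ← map_mul, awayMap_awayRatio_mul, map_one, map_one]

/-- Putting `x₀ = 1` and `x₁ = X` maps functions on the overlap to rational functions, fixing
constants and sending `t` to the transcendental element `X`. -/
lemma eval₂_t_injective : Function.Injective
    fun f : Polynomial ℂ => f.eval₂ (const P1.str (P1.chart 0 ⊓ P1.chart 1)) P1.t := by
  have : IsIso (Proj.awayToSection grading (MvPolynomial.X 0 * MvPolynomial.X 1)) :=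
    inferInstanceAs (IsIso (Proj.basicOpenIsoAway grading (MvPolynomial.X 0 * MvPolynomial.X 1)
      (SetLike.mul_mem_graded (X_mem 0) (X_mem 1)) two_pos).hom)
  let r := P1.presheaf.map (homOfLE chart_inf.ge).op ≫
    inv (Proj.awayToSection grading (MvPolynomial.X 0 * MvPolynomial.X 1))
  have hr (z) : r (P1.presheaf.map (homOfLE chart_inf.le).op (Proj.awayToSection grading
    (MvPolynomial.X 0 * MvPolynomial.X 1) z)) = z := by
    have h : Proj.awayToSection grading (MvPolynomial.X 0 * MvPolynomial.X 1) ≫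
        P1.presheaf.map (homOfLE chart_inf.le).op ≫ r = 𝟙 _ := by
      simp only [r]
      rw [← Functor.map_comp_assoc]
      have : (homOfLE chart_inf.le).op ≫ (homOfLE chart_inf.ge).op = 𝟙 _ := rfl
      rw [this, CategoryTheory.Functor.map_id, Category.id_comp, IsIso.hom_inv_id]
    exact congr($h z)
  let ρ := awayToRatFunc.comp r.hom
  have h1 : ρ P1.t = RatFunc.X := by
    have h : P1.t = _ := res_awayToSection (i := 0) (j := 1) rfl inf_le_left _
    rw [h]
    exact (congrArg awayToRatFunc (hr _)).trans awayToRatFunc_awayMap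
  have h2 (c) : ρ (const P1.str (P1.chart 0 ⊓ P1.chart 1) c) = RatFunc.C c := by
    rw [← map_const P1.str (inf_le_left : P1.chart 0 ⊓ P1.chart 1 ≤ P1.chart 0),
      ← awayToSection_awayConst, res_awayToSection (i := 0) (j := 1) rfl inf_le_left]
    refine (congrArg awayToRatFunc ((hr _).trans ?_)).trans (awayToRatFunc_awayConst c)
    exact awayMap_fromZeroRingHom ..
  intro f g hfg
  have h3 := congrArg ρ hfg
  simp only [Polynomial.hom_eval₂, h1] at h3
  have h4 : ρ.comp (const P1.str (P1.chart 0 ⊓ P1.chart 1)) = RatFunc.C := RingHom.ext h2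
  rw [h4] at h3
  have h5 (f : Polynomial ℂ) : f.eval₂ RatFunc.C RatFunc.X = algebraMap _ (RatFunc ℂ) f := by
    rw [← RatFunc.algebraMap_X, ← RatFunc.algebraMap_comp_C, ← Polynomial.hom_eval₂,
      Polynomial.eval₂_C_X]
  rw [h5, h5] at h3
  exact RatFunc.algebraMap_injective ℂ h3

/-- Two `ℂ`-points in a common chart with the same coordinate agree. -/
lemma point_ext {a b : Spec (.of ℂ) ⟶ P1} (ha : a ≫ P1.str = 𝟙 _) (hb : b ≫ P1.str = 𝟙 _)
    {i j : Fin 2} (hij : i ≠ j) (hai : pt a ∈ P1.chart i) (hbi : pt b ∈ P1.chart i)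
    (h : val a hai (ratio i j) = val b hbi (ratio i j)) : a = b := by
  -- Every function on the chart is a polynomial in the coordinate, so both points evaluate
  -- functions alike; the chart being affine, this determines the point.
  have h1 : val a hai = val b hbi := by
    ext α
    obtain ⟨f, rfl⟩ := exists_eval₂_ratio hij α
    rw [Polynomial.hom_eval₂, Polynomial.hom_eval₂, h]
    congr 1
    ext c
    simp [val_const ha, val_const hb]
  have h2 : a.appLE _ ⊤ (top_le_preimage hai) = b.appLE _ ⊤ (top_le_preimage hbi) := by
    rw [← cancel_mono (Scheme.ΓSpecIso (.of ℂ)).hom]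
    ext α
    exact congr($h1 α)
  have hU : IsAffineOpen (P1.chart i) := Proj.isAffineOpen_basicOpen grading _ (X_mem i) one_pos
  have hV := isAffineOpen_top (Spec (.of ℂ))
  have h3 := hU.SpecMap_appLE_fromSpec a hV (top_le_preimage hai)
  have h4 := hU.SpecMap_appLE_fromSpec b hV (top_le_preimage hbi)
  rw [h2, h4] at h3
  rw [IsAffineOpen.fromSpec_top] at h3
  exact ((cancel_epi _).mp h3).symm

end ProjectiveLine

/-! ### Local-to-global principles for sections, frames and morphisms. -/

section Local

variable {X Y : Scheme.{0}}

lemma section_eq_of_local {N : X.Modules} {V : X.Opens} {s t : Γ(N, V)}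
    (h : ∀ x ∈ V, ∃ (W : X.Opens) (hW : W ≤ V), x ∈ W ∧
      N.presheaf.map (homOfLE hW).op s = N.presheaf.map (homOfLE hW).op t) : s = t := by
  choose W hW hxW hst using h
  refine TopCat.Sheaf.eq_of_locally_eq' ⟨N.presheaf, N.isSheaf⟩ (fun x : V => W x.1 x.2) V
    (fun x => homOfLE (hW x.1 x.2)) ?_ s t fun x => hst x.1 x.2
  intro x hx
  exact TopologicalSpace.Opens.mem_iSup.mpr ⟨⟨x, hx⟩, hxW x hx⟩

/-- Gluing for a local condition `P` with at most one solution on each open: uniqueness makes the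
local solutions agree on overlaps. -/
lemma exists_section_of_local {N : X.Modules} {V : X.Opens}
    (P : ∀ W : X.Opens, W ≤ V → Γ(N, W) → Prop)
    (hres : ∀ (W W' : X.Opens) (hW : W ≤ V) (h : W' ≤ W) (m : Γ(N, W)), P W hW m →
      P W' (h.trans hW) (N.presheaf.map (homOfLE h).op m))
    (huniq : ∀ (W : X.Opens) (hW : W ≤ V) (m m' : Γ(N, W)), P W hW m → P W hW m' → m = m')
    (hloc : ∀ x ∈ V, ∃ (W : X.Opens) (hW : W ≤ V), x ∈ W ∧ ∃ m, P W hW m)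
    (hglue : ∀ m : Γ(N, V), (∀ x ∈ V, ∃ (W : X.Opens) (hW : W ≤ V), x ∈ W ∧
      P W hW (N.presheaf.map (homOfLE hW).op m)) → P V le_rfl m) :
    ∃ m : Γ(N, V), P V le_rfl m := by
  choose W hW hxW m hm using hloc
  obtain ⟨s, hs, -⟩ := TopCat.Sheaf.existsUnique_gluing' ⟨N.presheaf, N.isSheaf⟩
    (fun x : V => W x.1 x.2) V (fun x => homOfLE (hW x.1 x.2))
    (fun x hx => TopologicalSpace.Opens.mem_iSup.mpr ⟨⟨x, hx⟩, hxW x hx⟩)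
    (fun x => m x.1 x.2) (fun x y => huniq _ (inf_le_left.trans (hW x.1 x.2)) _ _
      (hres _ _ _ inf_le_left _ (hm x.1 x.2)) (hres _ _ _ inf_le_right _ (hm y.1 y.2)))
  refine ⟨s, hglue s fun x hx => ⟨W x hx, hW x hx, hxW x hx, ?_⟩⟩
  have := hs ⟨x, hx⟩
  exact this ▸ hm x hx

lemma IsFrame.smul_injective {M : X.Modules} {U : X.Opens} {e : Γ(M, U)} (he : IsFrame M U e)
    {a b : Γ(X, U)} (h : a • e = b • e) : a = b := by
  have := (he U le_rfl).1
  rw [presheaf_map_self] at this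
  exact this h

lemma IsFrame.exists_eq_smul {M : X.Modules} {U : X.Opens} {e : Γ(M, U)} (he : IsFrame M U e)
    (s : Γ(M, U)) : ∃ a : Γ(X, U), s = a • e := by
  obtain ⟨a, ha⟩ := (he U le_rfl).2 s
  rw [presheaf_map_self] at ha
  exact ⟨a, ha.symm⟩

/-- A section that is locally a frame is a frame. -/
lemma isFrame_of_local {M : X.Modules} {U : X.Opens} {e : Γ(M, U)}
    (h : ∀ x ∈ U, ∃ (W : X.Opens) (hW : W ≤ U), x ∈ W ∧
      IsFrame M W (M.presheaf.map (homOfLE hW).op e)) : IsFrame M U e := by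
  have hloc : ∀ (V : X.Opens) (hV : V ≤ U), ∀ x ∈ V, ∃ (W : X.Opens) (hW : W ≤ V), x ∈ W ∧
      IsFrame M W (M.presheaf.map (homOfLE (hW.trans hV)).op e) := by
    intro V hV x hx
    obtain ⟨W, hW, hxW, hf⟩ := h x (hV hx)
    refine ⟨W ⊓ V, inf_le_right, ⟨hxW, hx⟩, ?_⟩
    have := hf.restrict (inf_le_left : W ⊓ V ≤ W)
    rwa [presheaf_map_map] at this
  have hinj : ∀ (V : X.Opens) (hV : V ≤ U), Function.Injective
      fun f : Γ(X, V) => f • (M.presheaf.map (homOfLE hV).op e : Γ(M, V)) := by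
    intro V hV a b hab
    refine section_eq_of_local (N := unitModule X) (s := a) (t := b) fun x hx => ?_
    obtain ⟨W, hW, hxW, hf⟩ := hloc V hV x hx
    refine ⟨W, hW, hxW, hf.smul_injective ?_⟩
    have h1 := congrArg (M.presheaf.map (homOfLE hW).op) hab
    dsimp only at h1
    rw [Scheme.Modules.map_smul, Scheme.Modules.map_smul, presheaf_map_map] at h1
    exact h1
  intro V hV
  refine ⟨hinj V hV, fun s => ?_⟩
  have := exists_section_of_local (N := unitModule X) (V := V)
    (fun W hW (a : Γ(X, W)) => a • (M.presheaf.map (homOfLE (hW.trans hV)).op e : Γ(M, W)) =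
      M.presheaf.map (homOfLE hW).op s) ?_ ?_ ?_ ?_
  · obtain ⟨a, ha⟩ := this
    rw [presheaf_map_self] at ha
    exact ⟨a, ha⟩
  · intro W W' hW h (a : Γ(X, W)) ha
    have h1 := congrArg (M.presheaf.map (homOfLE h).op) ha
    rw [Scheme.Modules.map_smul, presheaf_map_map, presheaf_map_map] at h1
    exact h1
  · intro W hW a b ha hb
    exact hinj W (hW.trans hV) (ha.trans hb.symm)
  · intro x hx
    obtain ⟨W, hW, hxW, hf⟩ := hloc V hV x hx
    obtain ⟨a, ha⟩ := hf.exists_eq_smul (M.presheaf.map (homOfLE hW).op s)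
    exact ⟨W, hW, hxW, a, ha.symm⟩
  · intro (a : Γ(X, V)) ha
    apply section_eq_of_local
    intro x hx
    obtain ⟨W, hW, hxW, h1⟩ := ha x hx
    refine ⟨W, hW, hxW, ?_⟩
    rw [presheaf_map_self, Scheme.Modules.map_smul, presheaf_map_map]
    exact h1

lemma hom_eq_zero_of_frames {M N : X.Modules} {f : M ⟶ N}
    (h : ∀ x : X, ∃ (U : X.Opens) (e : Γ(M, U)), x ∈ U ∧ IsFrame M U e ∧ f.app U e = 0) :
    f = 0 := by
  apply Scheme.Modules.hom_ext
  intro V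
  ext s
  apply section_eq_of_local
  intro x hx
  obtain ⟨U, e, hxU, he, hfe⟩ := h x
  refine ⟨V ⊓ U, inf_le_left, ⟨hx, hxU⟩, ?_⟩
  obtain ⟨a, ha⟩ := (he.restrict (inf_le_right : V ⊓ U ≤ U)).exists_eq_smul
    (M.presheaf.map (homOfLE (inf_le_left : V ⊓ U ≤ V)).op s)
  rw [← hom_app_map, ha, Hom.app_smul, hom_app_map, hfe]
  simp

/-- Vanishing of a morphism between line bundles in the fibre at a point. -/
lemma fiber_map_eq_zero_iff (p : Spec (.of ℂ) ⟶ X) {M N : X.Modules} {f : M ⟶ N} {U : X.Opens}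
    (h : pt p ∈ U) {e : Γ(M, U)} {e' : Γ(N, U)} (he : IsFrame M U e) (he' : IsFrame N U e')
    {a : Γ(X, U)} (hf : f.app U e = a • e') : (fiber p).map f = 0 ↔ val p h a = 0 := by
  have h1 : (fiber p).map f (fiberSec p h e) = val p h a • fiberSec p h e' := by
    rw [fiber_map_fiberSec, hf, fiberSec_smul]
  have h2 := (he'.fiberSec_bijective p h).1
  constructor
  · intro h0
    rw [h0] at h1
    exact h2 (by simpa using h1.symm)
  · intro h0
    rw [h0, zero_smul] at h1
    ext x
    obtain ⟨c, rfl⟩ := (he.fiberSec_bijective p h).2 x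
    simp [h1]

end Local

/-! ### Morphisms between twists on the projective line. -/

section TwistHoms

open Polynomial

/-- With `s = 1 / t`, this compares the powers of `t` in `t ^ d * f(t) = t ^ d' * h(1 / t)`: the
coefficient of `f` in degree `k` must be that of `h` in degree `d' - d - k`, and both sides vanish
beyond this range. It is the computation of the sections of `𝒪(d' - d)`. -/
lemma coeff_of_eval₂_eq {S : Type*} [CommRing S] (i : ℂ →+* S) {t s : S} (hts : t * s = 1)
    (hinj : Function.Injective fun f : ℂ[X] => f.eval₂ i t) {f h : ℂ[X]} {d d' : ℕ}
    (heq : t ^ d * f.eval₂ i t = t ^ d' * h.eval₂ i s) :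
    (∀ k, d' < d + k → f.coeff k = 0 ∧ h.coeff k = 0) ∧
      ∀ k, d + k ≤ d' → f.coeff k = h.coeff (d' - d - k) := by
  -- `N` bounds the degree of `h`, so reversing `h` clears the powers of `s`; `d' ≤ N` keeps the
  -- subtraction in `d + N + k - d'` from truncating.
  obtain ⟨N, hN, hNd⟩ : ∃ N, h.natDegree ≤ N ∧ d' ≤ N := ⟨max h.natDegree d', by simp, by simp⟩
  let inv : Invertible s := ⟨t, hts, by rw [mul_comm, hts]⟩
  have h1 : (reflect N h).eval₂ i t * s ^ N = h.eval₂ i s := eval₂_reflect_mul_pow i s N h hN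
  have h2 : X ^ (d + N) * f = X ^ d' * reflect N h := by
    apply hinj
    simp only [eval₂_mul, eval₂_pow, eval₂_X]
    rw [pow_add, mul_right_comm, heq, ← h1]
    have h3 : t ^ N * s ^ N = 1 := by rw [← mul_pow, hts, one_pow]
    linear_combination (t ^ d' * (reflect N h).eval₂ i t) * h3
  have hf (k : ℕ) : f.coeff k = (reflect N h).coeff (d + N + k - d') := by
    have := congrArg (fun p => p.coeff (d + N + k)) h2
    simp only [coeff_X_pow_mul'] at this
    rw [if_pos (by omega), if_pos (by omega)] at this
    simpa using this
  refine ⟨fun k hk => ⟨?_, ?_⟩, fun k hk => ?_⟩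
  · rw [hf, coeff_reflect, revAt_eq_self_of_lt (by omega)]
    exact coeff_eq_zero_of_natDegree_lt (by omega)
  · by_cases hkN : N < k
    · exact coeff_eq_zero_of_natDegree_lt (by omega)
    · have := congrArg (fun p => p.coeff (d' + (N - k))) h2
      simp only [coeff_X_pow_mul'] at this
      rw [if_neg (by omega), if_pos (by omega), coeff_reflect] at this
      rw [revAt_le (by omega)] at this
      rw [this]
      congr 1
      omega
  · rw [hf, coeff_reflect, revAt_le (by omega)]
    congr 1
    omega

/-- Frames of a module on the projective line exhibiting it as `𝒪(d)`. -/
structure TwistFrames (M : P1.Modules) (d : ℕ) where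
  e₀ : Γ(M, P1.chart 0)
  e₁ : Γ(M, P1.chart 1)
  isFrame₀ : IsFrame M _ e₀
  isFrame₁ : IsFrame M _ e₁
  eq : (M.presheaf.map (homOfLE (inf_le_right : P1.chart 0 ⊓ P1.chart 1 ≤ P1.chart 1)).op e₁ :
      Γ(M, P1.chart 0 ⊓ P1.chart 1)) = P1.t ^ d •
      M.presheaf.map (homOfLE (inf_le_left : P1.chart 0 ⊓ P1.chart 1 ≤ P1.chart 0)).op e₀

lemma IsTwist.nonempty_twistFrames {M : P1.Modules} {d : ℕ} (h : IsTwist M d) :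
    Nonempty (TwistFrames M d) := by
  obtain ⟨e₀, e₁, h₀, h₁, h⟩ := h
  exact ⟨⟨e₀, e₁, h₀, h₁, h⟩⟩

variable {A B : P1.Modules} {d d' : ℕ}

/-- The coefficients of a morphism between twists are polynomials. -/
lemma exists_coeffs (F : TwistFrames A d) (G : TwistFrames B d') (g : A ⟶ B) :
    ∃ f h : ℂ[X], g.app _ F.e₀ = f.eval₂ (const P1.str _) (ratio 0 1) • G.e₀ ∧
      g.app _ F.e₁ = h.eval₂ (const P1.str _) (ratio 1 0) • G.e₁ ∧
      (∀ k, d' < d + k → f.coeff k = 0 ∧ h.coeff k = 0) ∧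
      ∀ k, d + k ≤ d' → f.coeff k = h.coeff (d' - d - k) := by
  obtain ⟨α, hα⟩ := G.isFrame₀.exists_eq_smul (g.app _ F.e₀)
  obtain ⟨β, hβ⟩ := G.isFrame₁.exists_eq_smul (g.app _ F.e₁)
  obtain ⟨f, rfl⟩ := exists_eval₂_ratio (i := 0) (j := 1) (by decide) α
  obtain ⟨h, rfl⟩ := exists_eval₂_ratio (i := 1) (j := 0) (by decide) β
  refine ⟨f, h, hα, hβ, ?_⟩
  apply coeff_of_eval₂_eq (const P1.str (P1.chart 0 ⊓ P1.chart 1)) P1.t_mul_s eval₂_t_injective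
  apply (G.isFrame₀.restrict (inf_le_left : P1.chart 0 ⊓ P1.chart 1 ≤ P1.chart 0)).smul_injective
  have h0 := congrArg (B.presheaf.map
    (homOfLE (inf_le_left : P1.chart 0 ⊓ P1.chart 1 ≤ P1.chart 0)).op) hα
  have h1 := congrArg (B.presheaf.map
    (homOfLE (inf_le_right : P1.chart 0 ⊓ P1.chart 1 ≤ P1.chart 1)).op) hβ
  rw [← hom_app_map, Scheme.Modules.map_smul] at h0 h1
  rw [F.eq, Hom.app_smul, h0, G.eq, smul_smul, smul_smul] at h1
  have e0 : P1.presheaf.map (homOfLE (inf_le_left : P1.chart 0 ⊓ P1.chart 1 ≤ P1.chart 0)).op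
      (f.eval₂ (const P1.str (P1.chart 0)) (ratio 0 1)) =
      f.eval₂ (const P1.str (P1.chart 0 ⊓ P1.chart 1)) P1.t := by
    refine (hom_eval₂ _ _ _ _).trans ?_
    congr 1
  have e1 : P1.presheaf.map (homOfLE (inf_le_right : P1.chart 0 ⊓ P1.chart 1 ≤ P1.chart 1)).op
      (h.eval₂ (const P1.str (P1.chart 1)) (ratio 1 0)) =
      h.eval₂ (const P1.str (P1.chart 0 ⊓ P1.chart 1)) P1.s := by
    refine (hom_eval₂ _ _ _ _).trans ?_
    congr 1
  rw [e0, e1] at h1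
  rw [h1, mul_comm]

lemma chart_cover (x : P1) : x ∈ P1.chart 0 ∨ x ∈ P1.chart 1 := by
  have h := Proj.iSup_basicOpen_eq_top' grading (fun i : Fin 2 => MvPolynomial.X i)
    (fun i => ⟨1, X_mem i⟩) ?_
  · have hx : x ∈ (⊤ : P1.Opens) := trivial
    rw [← h, TopologicalSpace.Opens.mem_iSup] at hx
    obtain ⟨i, hi⟩ := hx
    fin_cases i
    · exact .inl hi
    · exact .inr hi
  · rw [eq_top_iff]
    intro p _
    have hp : p ∈ Algebra.adjoin ℂ (Set.range (MvPolynomial.X : Fin 2 → MvPolynomial (Fin 2) ℂ)) := by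
      rw [MvPolynomial.adjoin_range_X]
      trivial
    induction hp using Algebra.adjoin_induction with
    | mem x hx => exact Algebra.subset_adjoin hx
    | algebraMap r => exact Subalgebra.algebraMap_mem _ (algebraMap ℂ (grading 0) r)
    | add x y _ _ hx hy => exact add_mem (hx trivial) (hy trivial)
    | mul x y _ _ hx hy => exact mul_mem (hx trivial) (hy trivial)

lemma hom_eq_zero_of_twistFrames (F : TwistFrames A d) {g : A ⟶ B} (h₀ : g.app _ F.e₀ = 0)
    (h₁ : g.app _ F.e₁ = 0) : g = 0 := by
  apply hom_eq_zero_of_frames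
  intro x
  rcases chart_cover x with hx | hx
  · exact ⟨_, _, hx, F.isFrame₀, h₀⟩
  · exact ⟨_, _, hx, F.isFrame₁, h₁⟩

/-- The twist `𝒪(d' - d)` has negative degree, so the comparison of coefficients leaves none. -/
lemma hom_eq_zero_of_lt (hA : IsTwist A d) (hB : IsTwist B d') (hd : d' < d) (g : A ⟶ B) :
    g = 0 := by
  obtain ⟨F⟩ := hA.nonempty_twistFrames
  obtain ⟨G⟩ := hB.nonempty_twistFrames
  obtain ⟨f, h, hf, hh, hc, -⟩ := exists_coeffs F G g
  have f0 : f = 0 := by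
    ext k
    exact (hc k (by omega)).1
  have h0 : h = 0 := by
    ext k
    exact (hc k (by omega)).2
  exact hom_eq_zero_of_twistFrames F (by simp [hf, f0]) (by simp [hh, h0])

lemma val_eval₂_ratio {a : Spec (.of ℂ) ⟶ P1} (ha : a ≫ P1.str = 𝟙 _) {i j : Fin 2}
    (h : pt a ∈ P1.chart i) (f : ℂ[X]) :
    val a h (f.eval₂ (const P1.str _) (ratio i j)) = f.eval (val a h (ratio i j)) := by
  rw [hom_eval₂]
  have : (val a h).comp (const P1.str _) = RingHom.id ℂ := by
    ext c
    exact val_const ha h c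
  rw [this]
  rfl

/-- Only the constant coefficient survives, and the value at any point recovers it. -/
lemma hom_eq_zero_of_eq (hA : IsTwist A d) (hB : IsTwist B d) (g : A ⟶ B)
    {a : Spec (.of ℂ) ⟶ P1} (ha : a ≫ P1.str = 𝟙 _) (hg : (fiber a).map g = 0) : g = 0 := by
  obtain ⟨F⟩ := hA.nonempty_twistFrames
  obtain ⟨G⟩ := hB.nonempty_twistFrames
  obtain ⟨f, h, hf, hh, hc, hc'⟩ := exists_coeffs F G g
  have hf0 : f = C (f.coeff 0) := by
    ext k
    rcases k with _ | k
    · simp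
    · rw [(hc _ (by omega)).1, coeff_C_succ]
  have hh0 : h = C (f.coeff 0) := by
    ext k
    rcases k with _ | k
    · simpa using (hc' 0 (by omega)).symm
    · rw [(hc _ (by omega)).2, coeff_C_succ]
  have hc0 : f.coeff 0 = 0 := by
    rcases chart_cover (pt a) with hx | hx
    · have := (fiber_map_eq_zero_iff a hx F.isFrame₀ G.isFrame₀ hf).mp hg
      rwa [val_eval₂_ratio ha, hf0, eval_C] at this
    · have := (fiber_map_eq_zero_iff a hx F.isFrame₁ G.isFrame₁ hh).mp hg
      rwa [val_eval₂_ratio ha, hh0, eval_C] at this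
  rw [hc0, C_0] at hf0 hh0
  exact hom_eq_zero_of_twistFrames F (by simp [hf, hf0]) (by simp [hh, hh0])

lemma SpecMap_awayToSection_comp_awayι (i : Fin 2) (hU : IsAffineOpen (P1.chart i)) :
    Spec.map (Proj.awayToSection grading (MvPolynomial.X i)) ≫
      Proj.awayι grading (MvPolynomial.X i) (X_mem i) one_pos = hU.fromSpec := by
  rw [← cancel_epi hU.isoSpec.hom, IsAffineOpen.isoSpec_hom_fromSpec, IsAffineOpen.isoSpec_hom,
    Proj.awayι, ← Category.assoc, ← Category.assoc]
  change (Proj.basicOpenToSpec grading (MvPolynomial.X i) ≫ _) ≫ _ = _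
  rw [← Proj.basicOpenIsoSpec_hom grading (MvPolynomial.X i) (X_mem i) one_pos, Iso.hom_inv_id,
    Category.id_comp]

/-- Inside the affine chart `D₊(x_i)`, the open `D₊(x_j)` is the locus where `x_j / x_i` is
invertible. -/
lemma mem_chart_of_val_ne_zero {a : Spec (.of ℂ) ⟶ P1} {i j : Fin 2}
    (h : pt a ∈ P1.chart i) (hv : val a h (ratio i j) ≠ 0) : pt a ∈ P1.chart j := by
  have hU : IsAffineOpen (P1.chart i) := Proj.isAffineOpen_basicOpen grading _ (X_mem i) one_pos
  have hV := isAffineOpen_top (Spec (.of ℂ))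
  have h3 := hU.SpecMap_appLE_fromSpec a hV (top_le_preimage h)
  rw [← SpecMap_awayToSection_comp_awayι, IsAffineOpen.fromSpec_top, ← Category.assoc,
    ← Spec.map_comp] at h3
  set φ := Proj.awayToSection grading (MvPolynomial.X i) ≫ a.appLE _ ⊤ (top_le_preimage h)
  have h4 := Proj.awayι_preimage_basicOpen grading (X_mem i) one_pos (X_mem j) one_pos
  have h5 : a = (Spec (.of ℂ)).isoSpec.hom ≫ Spec.map φ ≫
      Proj.awayι grading (MvPolynomial.X i) (X_mem i) one_pos := by
    rw [h3, Iso.hom_inv_id_assoc]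
  let y : Spec Γ(Spec (.of ℂ), ⊤) := (Spec (.of ℂ)).isoSpec.hom (IsLocalRing.closedPoint ℂ)
  have h6 : pt a = Proj.awayι grading (MvPolynomial.X i) (X_mem i) one_pos (Spec.map φ y) := by
    rw [pt, h5]
    rfl
  have h7 : IsUnit (φ (awayRatio i j)) := by
    have h8 : IsUnit ((Scheme.ΓSpecIso (.of ℂ)).hom (φ (awayRatio i j))) := isUnit_iff_ne_zero.mpr hv
    have h9 := h8.map (Scheme.ΓSpecIso (.of ℂ)).inv.hom
    have h10 : (Scheme.ΓSpecIso (.of ℂ)).inv ((Scheme.ΓSpecIso (.of ℂ)).hom (φ (awayRatio i j))) =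
        φ (awayRatio i j) := congr($((Scheme.ΓSpecIso (.of ℂ)).hom_inv_id) _)
    exact h10 ▸ h9
  rw [h6]
  have h9 : Spec.map φ y ∈ Proj.awayι grading (MvPolynomial.X i) (X_mem i) one_pos ⁻¹ᵁ
      Proj.basicOpen grading (MvPolynomial.X j) := by
    rw [h4]
    intro h10
    have h11 : awayRatio i j ∈ (Spec.map φ y).asIdeal := by
      convert h10 using 1
      apply HomogeneousLocalization.val_injective
      simp [awayRatio]
    exact y.isPrime.ne_top (Ideal.eq_top_of_isUnit_mem _ h11 h7)
  exact h9

lemma val_ratio_mul {a : Spec (.of ℂ) ⟶ P1} (h₀ : pt a ∈ P1.chart 0) (h₁ : pt a ∈ P1.chart 1) :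
    val a h₀ (ratio 0 1) * val a h₁ (ratio 1 0) = 1 := by
  have h₀₁ : pt a ∈ P1.chart 0 ⊓ P1.chart 1 := ⟨h₀, h₁⟩
  have h := congrArg (val a h₀₁) P1.t_mul_s
  rw [map_mul, map_one, P1.t, P1.s, val_map, val_map] at h
  exact h

/-- `(u, v)` are homogeneous coordinates of the `ℂ`-point `a`, normalized on one of the charts. -/
def HasCoords (a : Spec (.of ℂ) ⟶ P1) (u v : ℂ) : Prop :=
  (∃ h : pt a ∈ P1.chart 0, u = 1 ∧ v = val a h (ratio 0 1)) ∨
    ∃ h : pt a ∈ P1.chart 1, v = 1 ∧ u = val a h (ratio 1 0)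

lemma exists_hasCoords (a : Spec (.of ℂ) ⟶ P1) : ∃ u v, HasCoords a u v := by
  rcases chart_cover (pt a) with h | h
  · exact ⟨_, _, .inl ⟨h, rfl, rfl⟩⟩
  · exact ⟨_, _, .inr ⟨h, rfl, rfl⟩⟩

/-- Distinct points of the projective line have non-proportional homogeneous coordinates. -/
lemma HasCoords.det_ne_zero {a b : Spec (.of ℂ) ⟶ P1} (ha : a ≫ P1.str = 𝟙 _)
    (hb : b ≫ P1.str = 𝟙 _) (hab : a ≠ b) {u v u' v' : ℂ} (h : HasCoords a u v)
    (h' : HasCoords b u' v') : u * v' - u' * v ≠ 0 := by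
  -- For points normalized on different charts, a zero determinant says that the two coordinates are
  -- mutually inverse; then both are nonzero and `b` also lies in the first chart.
  have mixed {a b : Spec (.of ℂ) ⟶ P1} (ha : a ≫ P1.str = 𝟙 _)
      (hb : b ≫ P1.str = 𝟙 _) (h0 : pt a ∈ P1.chart 0) (h1 : pt b ∈ P1.chart 1)
      (he : val a h0 (ratio 0 1) * val b h1 (ratio 1 0) = 1) : a = b := by
    have hb0 : pt b ∈ P1.chart 0 := mem_chart_of_val_ne_zero h1 (right_ne_zero_of_mul_eq_one he)
    apply point_ext ha hb (by decide : (0 : Fin 2) ≠ 1) h0 hb0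
    have := val_ratio_mul hb0 h1
    exact mul_right_cancel₀ (right_ne_zero_of_mul_eq_one he) (he.trans this.symm)
  intro hdet
  apply hab
  rcases h with ⟨h, rfl, rfl⟩ | ⟨h, rfl, rfl⟩ <;> rcases h' with ⟨h', rfl, rfl⟩ | ⟨h', rfl, rfl⟩
  · exact point_ext ha hb (by decide : (0 : Fin 2) ≠ 1) h h' (by linear_combination -hdet)
  · exact mixed ha hb h h' (by linear_combination -hdet)
  · exact (mixed hb ha h' h (by linear_combination hdet)).symm
  · exact point_ext ha hb (by decide : (1 : Fin 2) ≠ 0) h h' (by linear_combination hdet)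

/-- A morphism `𝒪 ⟶ 𝒪(1)` with coefficients `c₀, c₁` vanishes at the zeros of a linear form. -/
lemma fiber_map_eq_zero_iff_of_linear (F : TwistFrames A d) (G : TwistFrames B d') {g : A ⟶ B}
    {c₀ c₁ : ℂ}
    (h₀ : g.app _ F.e₀ = (C c₀ + C c₁ * X : ℂ[X]).eval₂ (const P1.str _) (ratio 0 1) • G.e₀)
    (h₁ : g.app _ F.e₁ = (C c₁ + C c₀ * X : ℂ[X]).eval₂ (const P1.str _) (ratio 1 0) • G.e₁)
    {a : Spec (.of ℂ) ⟶ P1} (ha : a ≫ P1.str = 𝟙 _) {u v : ℂ} (hc : HasCoords a u v) :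
    (fiber a).map g = 0 ↔ c₀ * u + c₁ * v = 0 := by
  rcases hc with ⟨h, rfl, rfl⟩ | ⟨h, rfl, rfl⟩
  · rw [fiber_map_eq_zero_iff a h F.isFrame₀ G.isFrame₀ h₀, val_eval₂_ratio ha]
    simp
  · rw [fiber_map_eq_zero_iff a h F.isFrame₁ G.isFrame₁ h₁, val_eval₂_ratio ha]
    simp [add_comm]

/-- Such a morphism is a linear form `c₀ x₀ + c₁ x₁`; two distinct zeros give a linear system for
`c₀, c₁` with nonzero determinant. -/
lemma hom_eq_zero_of_two_zeros (hA : IsTwist A 0) (hB : IsTwist B 1) (g : A ⟶ B)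
    {a b : Spec (.of ℂ) ⟶ P1} (ha : a ≫ P1.str = 𝟙 _) (hb : b ≫ P1.str = 𝟙 _) (hab : a ≠ b)
    (hga : (fiber a).map g = 0) (hgb : (fiber b).map g = 0) : g = 0 := by
  obtain ⟨F⟩ := hA.nonempty_twistFrames
  obtain ⟨G⟩ := hB.nonempty_twistFrames
  obtain ⟨f, h, hf, hh, hc, hc'⟩ := exists_coeffs F G g
  have e0 := hc' 0 (by omega)
  have e1 := hc' 1 (by omega)
  have hf0 : f = C (f.coeff 0) + C (f.coeff 1) * X := by
    ext k
    rcases k with _ | _ | k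
    · simp
    · simp
    · rw [(hc _ (by omega)).1]
      simp
  have hh0 : h = C (f.coeff 1) + C (f.coeff 0) * X := by
    ext k
    rcases k with _ | _ | k
    · simp [e1]
    · simp [e0]
    · rw [(hc _ (by omega)).2]
      simp
  generalize f.coeff 0 = c₀ at *
  generalize f.coeff 1 = c₁ at *
  subst hf0 hh0
  obtain ⟨u, v, hu⟩ := exists_hasCoords a
  obtain ⟨u', v', hu'⟩ := exists_hasCoords b
  rw [fiber_map_eq_zero_iff_of_linear F G hf hh ha hu] at hga
  rw [fiber_map_eq_zero_iff_of_linear F G hf hh hb hu'] at hgb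
  have hdet := hu.det_ne_zero ha hb hab hu'
  have hc0 : c₀ = 0 := mul_left_cancel₀ hdet (by linear_combination v' * hga - v * hgb)
  have hc1 : c₁ = 0 := mul_left_cancel₀ hdet (by linear_combination u * hgb - u' * hga)
  subst hc0 hc1
  exact hom_eq_zero_of_twistFrames F (by simp [hf]) (by simp [hh])

lemma exists_section_of_charts (e₀ : Γ(A, P1.chart 0)) (e₁ : Γ(A, P1.chart 1))
    (h : (A.presheaf.map (homOfLE (inf_le_left : P1.chart 0 ⊓ P1.chart 1 ≤ P1.chart 0)).op e₀ :
      Γ(A, P1.chart 0 ⊓ P1.chart 1)) =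
      A.presheaf.map (homOfLE (inf_le_right : P1.chart 0 ⊓ P1.chart 1 ≤ P1.chart 1)).op e₁) :
    ∃ e : Γ(A, ⊤), A.presheaf.map (homOfLE le_top).op e = e₀ ∧
      A.presheaf.map (homOfLE le_top).op e = e₁ := by
  let sf : ∀ i : Fin 2, Γ(A, P1.chart i) := fun i => match i with
    | 0 => e₀
    | 1 => e₁
  have hcover : (⊤ : P1.Opens) ≤ ⨆ i : Fin 2, P1.chart i := by
    intro x _
    rw [TopologicalSpace.Opens.mem_iSup]
    rcases chart_cover x with hx | hx
    exacts [⟨0, hx⟩, ⟨1, hx⟩]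
  have hcompat : TopCat.Presheaf.IsCompatible A.presheaf (fun i : Fin 2 => P1.chart i) sf := by
    intro i j
    match i, j with
    | 0, 0 => rfl
    | 0, 1 => exact h
    | 1, 0 =>
      have h1 := congrArg (A.presheaf.map (homOfLE (inf_comm _ _).le :
        P1.chart 1 ⊓ P1.chart 0 ⟶ P1.chart 0 ⊓ P1.chart 1).op) h
      rw [presheaf_map_map, presheaf_map_map] at h1
      exact h1.symm
    | 1, 1 => rfl
  obtain ⟨e, he, -⟩ := TopCat.Sheaf.existsUnique_gluing' ⟨A.presheaf, A.isSheaf⟩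
    (fun i : Fin 2 => P1.chart i) ⊤ (fun i => homOfLE le_top) hcover sf hcompat
  exact ⟨e, he 0, he 1⟩

/-- A trivial line bundle on the projective line has a global frame. -/
lemma IsTwist.exists_isFrame_top (hA : IsTwist A 0) : ∃ e : Γ(A, ⊤), IsFrame A ⊤ e := by
  obtain ⟨F⟩ := hA.nonempty_twistFrames
  have h := F.eq
  rw [pow_zero, one_smul] at h
  obtain ⟨e, h₀, h₁⟩ := exists_section_of_charts _ _ h.symm
  refine ⟨e, isFrame_of_local fun x _ => ?_⟩
  rcases chart_cover x with hx | hx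
  · exact ⟨_, le_top, hx, h₀ ▸ F.isFrame₀⟩
  · exact ⟨_, le_top, hx, h₁ ▸ F.isFrame₁⟩

lemma exists_isIso_of_isTwist_zero (hA : IsTwist A 0) (hB : IsTwist B 0) :
    ∃ g : A ⟶ B, IsIso g := by
  obtain ⟨e, he⟩ := hA.exists_isFrame_top
  obtain ⟨e', he'⟩ := hB.exists_isFrame_top
  have := isIso_homOfSection he
  have := isIso_homOfSection he'
  exact ⟨inv (homOfSection e) ≫ homOfSection e', inferInstance⟩

lemma exists_hom_of_isFrame_top {X : Scheme.{0}} {M N : X.Modules} {e : Γ(M, ⊤)}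
    (he : IsFrame M ⊤ e) (m : Γ(N, ⊤)) : ∃ g : M ⟶ N, g.app ⊤ e = m := by
  have := isIso_homOfSection he
  refine ⟨inv (homOfSection e) ≫ homOfSection m, ?_⟩
  have h1 : homOfSection e ≫ inv (homOfSection e) ≫ homOfSection m = homOfSection m := by simp
  have h2 := congr(Scheme.Modules.Hom.app $h1 ⊤ (unitOne X ⊤))
  rw [homOfSection_unitOne, presheaf_map_self] at h2
  refine Eq.trans ?_ h2
  have h3 := homOfSection_unitOne e ⊤
  rw [presheaf_map_self] at h3
  exact congrArg (Scheme.Modules.Hom.app (inv (homOfSection e) ≫ homOfSection m) ⊤) h3.symm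

/-- A morphism `𝒪 ⟶ 𝒪(1)` with a zero at a prescribed point and no other zero. -/
lemma exists_hom_vanishing_at (hA : IsTwist A 0) (hB : IsTwist B 1) {a : Spec (.of ℂ) ⟶ P1}
    (ha : a ≫ P1.str = 𝟙 _) : ∃ g : A ⟶ B, (fiber a).map g = 0 ∧
      ∀ b : Spec (.of ℂ) ⟶ P1, b ≫ P1.str = 𝟙 _ → b ≠ a → (fiber b).map g ≠ 0 := by
  obtain ⟨e, he⟩ := hA.exists_isFrame_top
  obtain ⟨G⟩ := hB.nonempty_twistFrames
  obtain ⟨u, v, hu⟩ := exists_hasCoords a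
  let F : TwistFrames A 0 :=
    { e₀ := A.presheaf.map (homOfLE le_top).op e
      e₁ := A.presheaf.map (homOfLE le_top).op e
      isFrame₀ := he.restrict _
      isFrame₁ := he.restrict _
      eq := by rw [presheaf_map_map, presheaf_map_map, pow_zero, one_smul] }
  -- The section is the linear form `v x₀ - u x₁`, whose only zero is `(u : v)`, written in the two
  -- charts.
  obtain ⟨m, hm₀, hm₁⟩ := exists_section_of_charts
    ((C v + C (-u) * X : ℂ[X]).eval₂ (const P1.str _) (ratio 0 1) • G.e₀)
    ((C (-u) + C v * X : ℂ[X]).eval₂ (const P1.str _) (ratio 1 0) • G.e₁) (by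
      rw [Scheme.Modules.map_smul, Scheme.Modules.map_smul, G.eq, smul_smul, pow_one]
      congr 1
      simp only [eval₂_add, eval₂_mul, eval₂_C, eval₂_X, map_add, map_mul, map_const]
      change _ + _ * P1.t = (_ + _ * P1.s) * P1.t
      linear_combination (- const P1.str (P1.chart 0 ⊓ P1.chart 1) v) * P1.t_mul_s)
  obtain ⟨g, hg⟩ := exists_hom_of_isFrame_top he m
  have h₀ : g.app _ F.e₀ = (C v + C (-u) * X : ℂ[X]).eval₂ (const P1.str _) (ratio 0 1) • G.e₀ := by
    rw [← hm₀, ← hg, ← hom_app_map]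
  have h₁ : g.app _ F.e₁ = (C (-u) + C v * X : ℂ[X]).eval₂ (const P1.str _) (ratio 1 0) • G.e₁ := by
    rw [← hm₁, ← hg, ← hom_app_map]
  refine ⟨g, ?_, fun b hb hba => ?_⟩
  · rw [fiber_map_eq_zero_iff_of_linear F G h₀ h₁ ha hu]
    ring
  · obtain ⟨u', v', hu'⟩ := exists_hasCoords b
    rw [ne_eq, fiber_map_eq_zero_iff_of_linear F G h₀ h₁ hb hu']
    have := hu'.det_ne_zero hb ha hba hu
    intro h
    exact this (by linear_combination h)

end TwistHoms

/-! ### Nodes of the chain, and gluing of functions from the components. -/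

section ChainGeometry

/-- For surjections the pushout is `A / (ker f + ker g)`: the quotient by the sum receives
compatible maps from `B` and `C`, hence a map from `P`. -/
lemma mem_ker_sup_ker_of_isPushout {A B C P : CommRingCat.{0}} {f : A ⟶ B} {g : A ⟶ C} {h : B ⟶ P}
    {k : C ⟶ P} (sq : IsPushout f g h k) (hf : Function.Surjective f) (hg : Function.Surjective g)
    {x : A} (hx : h (f x) = 0) : x ∈ RingHom.ker f.hom ⊔ RingHom.ker g.hom := by
  let I := RingHom.ker f.hom ⊔ RingHom.ker g.hom
  let mk : A →+* A ⧸ I := Ideal.Quotient.mk I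
  let b : B →+* A ⧸ I := f.hom.liftOfSurjective hf ⟨mk, fun a ha => by
    rw [RingHom.mem_ker, Ideal.Quotient.eq_zero_iff_mem]
    exact Ideal.mem_sup_left ha⟩
  let c : C →+* A ⧸ I := g.hom.liftOfSurjective hg ⟨mk, fun a ha => by
    rw [RingHom.mem_ker, Ideal.Quotient.eq_zero_iff_mem]
    exact Ideal.mem_sup_right ha⟩
  have hb (a) : b (f a) = mk a := RingHom.liftOfRightInverse_comp_apply _ _ _ _ _
  have hc (a) : c (g a) = mk a := RingHom.liftOfRightInverse_comp_apply _ _ _ _ _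
  let d : P ⟶ CommRingCat.of (A ⧸ I) := sq.desc (CommRingCat.ofHom b) (CommRingCat.ofHom c) (by
    ext a
    exact (hb a).trans (hc a).symm)
  have hd : h ≫ d = CommRingCat.ofHom b := sq.inl_desc _ _ _
  have h1 : d (h (f x)) = mk x := (congr($hd (f x))).trans (hb x)
  rw [hx, map_zero] at h1
  exact Ideal.Quotient.eq_zero_iff_mem.mp h1.symm

lemma app_eq_zero_of_val {X : Scheme.{0}} {p : Spec (.of ℂ) ⟶ X} {U : X.Opens} {b : Γ(X, U)}
    (h : ∀ hm : pt p ∈ U, val p hm b = 0) : p.app U b = 0 := by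
  by_cases hm : pt p ∈ U
  · have h1 : p.appLE U ⊤ (top_le_preimage hm) b = 0 :=
      (ConcreteCategory.bijective_of_isIso (Scheme.ΓSpecIso (.of ℂ)).hom).1 (by
        rw [map_zero]
        exact h hm)
    have h2 := p.appLE_map (top_le_preimage hm) (homOfLE (le_top : p ⁻¹ᵁ U ≤ ⊤)).op
    rw [Scheme.Hom.appLE_eq_app] at h2
    rw [← h2, ConcreteCategory.comp_apply, h1, map_zero]
  · have h1 : p ⁻¹ᵁ U = ⊥ := by
      rw [eq_bot_iff]
      intro x hx
      rw [eq_closedPoint x] at hx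
      exact hm hx
    have : Subsingleton Γ(Spec (.of ℂ), p ⁻¹ᵁ U) := by
      rw [h1]
      infer_instance
    exact Subsingleton.elim _ _

lemma val_congr {X : Scheme.{0}} {p q : Spec (.of ℂ) ⟶ X} (h : p = q) {U : X.Opens}
    (hm : pt p ∈ U) (b : Γ(X, U)) : val p hm b = val q (h ▸ hm) b := by
  subst h
  rfl

namespace Chain

variable {n : ℕ} (C : Chain n)

instance (i : Fin n) : IsClosedImmersion (C.comp i) := C.isClosedImmersion i

instance : IsReduced C.R := C.isReduced

/-- The `ℂ`-point of `R_i` in which `R_i` meets `R_j`, where `j = i + 1`. -/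
def nodeLeft {i j : Fin n} (h : i.val + 1 = j.val) : Spec (.of ℂ) ⟶ P1 :=
  haveI := C.meet i j h
  inv (Limits.pullback.fst (C.comp i) (C.comp j) ≫ C.comp i ≫ C.str) ≫ Limits.pullback.fst _ _

/-- The `ℂ`-point of `R_j` in which `R_i` meets `R_j`, where `j = i + 1`. -/
def nodeRight {i j : Fin n} (h : i.val + 1 = j.val) : Spec (.of ℂ) ⟶ P1 :=
  haveI := C.meet i j h
  inv (Limits.pullback.fst (C.comp i) (C.comp j) ≫ C.comp i ≫ C.str) ≫ Limits.pullback.snd _ _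

/-- The `ℂ`-point of `R` in which `R_i` meets `R_j`, where `j = i + 1`. -/
def node {i j : Fin n} (h : i.val + 1 = j.val) : Spec (.of ℂ) ⟶ C.R := C.nodeLeft h ≫ C.comp i

lemma nodeLeft_comp {i j : Fin n} (h : i.val + 1 = j.val) : C.nodeLeft h ≫ C.comp i = C.node h :=
  rfl

lemma nodeRight_comp {i j : Fin n} (h : i.val + 1 = j.val) :
    C.nodeRight h ≫ C.comp j = C.node h := by
  simp only [node, nodeLeft, nodeRight, Category.assoc, Limits.pullback.condition]

lemma nodeLeft_str {i j : Fin n} (h : i.val + 1 = j.val) : C.nodeLeft h ≫ P1.str = 𝟙 _ := by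
  have := C.meet i j h
  rw [← C.comp_str i, nodeLeft, Category.assoc, IsIso.inv_hom_id]

lemma nodeRight_str {i j : Fin n} (h : i.val + 1 = j.val) : C.nodeRight h ≫ P1.str = 𝟙 _ := by
  rw [← C.comp_str j, ← Category.assoc, nodeRight_comp, ← nodeLeft_comp, Category.assoc, C.comp_str,
    nodeLeft_str]

/-- The non-vanishing locus of `b` misses every component, hence is empty, and `R` is reduced. -/
lemma eq_zero_of_app_eq_zero {U : C.R.Opens} {b : Γ(C.R, U)}
    (h : ∀ k, (C.comp k).app U b = 0) : b = 0 := by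
  apply eq_zero_of_basicOpen_eq_bot
  rw [eq_bot_iff]
  intro x hx
  obtain ⟨k, y, rfl⟩ := C.covers x
  have hy : y ∈ C.comp k ⁻¹ᵁ C.R.basicOpen b := hx
  rw [Scheme.preimage_basicOpen, h k, Scheme.basicOpen_zero] at hy
  exact hy.elim

lemma app_surjective {U : C.R.Opens} (hU : IsAffineOpen U) (k : Fin n) :
    Function.Surjective ((C.comp k).app U) :=
  (C.comp k).app_surjective U hU

lemma subsingleton_of_preimage_eq_bot {U : C.R.Opens} {k : Fin n} (h : C.comp k ⁻¹ᵁ U = ⊥) :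
    Subsingleton Γ(P1, C.comp k ⁻¹ᵁ U) := by
  rw [h]
  infer_instance

lemma exists_glue_single {U : C.R.Opens} (hU : IsAffineOpen U) (i : Fin n)
    (hi : ∀ k, k ≠ i → C.comp k ⁻¹ᵁ U = ⊥) (a : ∀ k, Γ(P1, C.comp k ⁻¹ᵁ U)) :
    ∃ b : Γ(C.R, U), ∀ k, (C.comp k).app U b = a k := by
  obtain ⟨b, hb⟩ := C.app_surjective hU i (a i)
  refine ⟨b, fun k => ?_⟩
  by_cases hk : k = i
  · subst hk
    exact hb
  · have := C.subsingleton_of_preimage_eq_bot (hi k hk)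
    exact Subsingleton.elim _ _

lemma preimage_fst_le (i j : Fin n) (U : C.R.Opens) :
    Limits.pullback.fst (C.comp i) (C.comp j) ⁻¹ᵁ C.comp i ⁻¹ᵁ U ≤
      Limits.pullback.snd (C.comp i) (C.comp j) ⁻¹ᵁ C.comp j ⁻¹ᵁ U := by
  rw [← Scheme.Hom.comp_preimage, ← Scheme.Hom.comp_preimage, Limits.pullback.condition]

/-- Functions on the scheme-theoretic intersection `R_i ∩ R_j` over an affine open are the tensor
product of the functions on the two components. -/
lemma isPushout_app {U : C.R.Opens} (hU : IsAffineOpen U) (i j : Fin n) :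
    IsPushout ((C.comp i).app U) ((C.comp j).app U)
      ((Limits.pullback.fst (C.comp i) (C.comp j)).app (C.comp i ⁻¹ᵁ U))
      ((Limits.pullback.snd (C.comp i) (C.comp j)).appLE (C.comp j ⁻¹ᵁ U)
        (Limits.pullback.fst (C.comp i) (C.comp j) ⁻¹ᵁ C.comp i ⁻¹ᵁ U)
        (C.preimage_fst_le i j U)) := by
  have h := isIso_pushoutSection_of_isAffineOpen
    (IsPullback.of_hasPullback (C.comp i) (C.comp j)) (US := U) (UT := C.comp j ⁻¹ᵁ U)
    (UX := C.comp i ⁻¹ᵁ U) le_rfl le_rfl (inf_eq_left.mpr (C.preimage_fst_le i j U)).symm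
    hU (hU.preimage _) (hU.preimage _)
  rw [isIso_pushoutSection_iff] at h
  simpa only [Scheme.Hom.appLE_eq_app] using h

/-- A function on `R_i ∩ R_j` vanishes when its value at the node does. -/
lemma fst_app_eq_of_val_eq {i j : Fin n} (h : i.val + 1 = j.val) {U : C.R.Opens}
    {b : Γ(C.R, U)} (hb : ∀ hm : pt (C.node h) ∈ U, val (C.node h) hm b = 0) :
    (Limits.pullback.fst (C.comp i) (C.comp j)).app (C.comp i ⁻¹ᵁ U) ((C.comp i).app U b) = 0 := by
  have := C.meet i j h
  let z := inv (Limits.pullback.fst (C.comp i) (C.comp j) ≫ C.comp i ≫ C.str)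
  have h1 : z ≫ Limits.pullback.fst (C.comp i) (C.comp j) ≫ C.comp i = C.node h := by
    simp only [node, nodeLeft, Category.assoc, z]
  have h2 : (z ≫ Limits.pullback.fst (C.comp i) (C.comp j) ≫ C.comp i).app U b = 0 := by
    apply app_eq_zero_of_val
    rw [h1]
    exact hb
  have h3 := (ConcreteCategory.bijective_of_isIso (z.app
    (Limits.pullback.fst (C.comp i) (C.comp j) ⁻¹ᵁ C.comp i ⁻¹ᵁ U))).1
  apply h3
  rw [map_zero]
  rw [Scheme.Hom.comp_app, Scheme.Hom.comp_app] at h2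
  exact h2

/-- Lifts of the two functions differ by a function vanishing at the node. As the scheme-theoretic
intersection is the reduced node, that difference is a sum of functions vanishing on `R_i` and on
`R_j`, by which the lifts can be corrected. -/
lemma exists_glue_pair {U : C.R.Opens} (hU : IsAffineOpen U) {i j : Fin n}
    (h : i.val + 1 = j.val) (hij : ∀ k, k ≠ i → k ≠ j → C.comp k ⁻¹ᵁ U = ⊥)
    (a : ∀ k, Γ(P1, C.comp k ⁻¹ᵁ U))
    (ha : ∀ (h₁ : pt (C.nodeLeft h) ∈ C.comp i ⁻¹ᵁ U) (h₂ : pt (C.nodeRight h) ∈ C.comp j ⁻¹ᵁ U),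
      val (C.nodeLeft h) h₁ (a i) = val (C.nodeRight h) h₂ (a j)) :
    ∃ b : Γ(C.R, U), ∀ k, (C.comp k).app U b = a k := by
  obtain ⟨bi, hbi⟩ := C.app_surjective hU i (a i)
  obtain ⟨bj, hbj⟩ := C.app_surjective hU j (a j)
  have hne : i ≠ j := by rintro rfl; omega
  have h0 : bi - bj ∈ RingHom.ker ((C.comp i).app U).hom ⊔ RingHom.ker ((C.comp j).app U).hom := by
    apply mem_ker_sup_ker_of_isPushout (C.isPushout_app hU i j) (C.app_surjective hU i)
      (C.app_surjective hU j)
    apply C.fst_app_eq_of_val_eq h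
    intro hm
    have hm' : pt (C.nodeRight h ≫ C.comp j) ∈ U := by rwa [nodeRight_comp]
    have h1 : val (C.node h) hm bi = val (C.nodeLeft h) (U := C.comp i ⁻¹ᵁ U) hm (a i) := by
      rw [← hbi]
      exact val_comp _ _ hm _
    have h2 : val (C.node h) hm bj = val (C.nodeRight h) (U := C.comp j ⁻¹ᵁ U) hm' (a j) := by
      rw [← hbj, val_congr (C.nodeRight_comp h).symm]
      exact val_comp _ _ hm' _
    rw [map_sub, h1, h2, ha hm hm', sub_self]
  obtain ⟨u, hu, w, hw, huw⟩ := Submodule.mem_sup.mp h0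
  rw [RingHom.mem_ker] at hu hw
  -- `bi - bj = u + w`, so `bi - u = bj + w` restricts correctly to both components.
  refine ⟨bi - u, fun k => ?_⟩
  by_cases hk : k = i
  · subst hk
    rw [map_sub, hbi]
    exact (sub_eq_self (a := a k)).mpr hu
  by_cases hk' : k = j
  · subst hk'
    have : bi - u = bj + w := by linear_combination -huw
    rw [this, map_add, hbj]
    exact (add_eq_left (a := a k)).mpr hw
  have := C.subsingleton_of_preimage_eq_bot (hij k hk hk')
  exact Subsingleton.elim _ _

/-- The pieces of the chain through a point. -/
lemma exists_affine_nbhd (x : C.R) (V : C.R.Opens) (hx : x ∈ V) :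
    ∃ U : C.R.Opens, IsAffineOpen U ∧ x ∈ U ∧ U ≤ V ∧
      ((∃ i, ∀ k, k ≠ i → C.comp k ⁻¹ᵁ U = ⊥) ∨
        ∃ (i j : Fin n) (_ : i.val + 1 = j.val), ∀ k, k ≠ i → k ≠ j → C.comp k ⁻¹ᵁ U = ⊥) := by
  -- `W` removes the components not containing `x`. At most two remain, and these are consecutive,
  -- since all other pairs are disjoint.
  let W : C.R.Opens := ⟨(⋃ k ∈ {k : Fin n | x ∉ Set.range (C.comp k)}, Set.range (C.comp k))ᶜ, by
    rw [isOpen_compl_iff]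
    exact (Set.toFinite _).isClosed_biUnion fun k _ => (C.comp k).isClosedEmbedding.isClosed_range⟩
  have hxW : x ∈ W := by
    intro h
    simp only [Set.mem_iUnion] at h
    obtain ⟨k, hk, hk'⟩ := h
    exact hk hk'
  obtain ⟨U, hU, hxU, hUV⟩ := exists_isAffineOpen_mem_and_subset (U := V ⊓ W) ⟨hx, hxW⟩
  have hbot (k : Fin n) (hk : x ∉ Set.range (C.comp k)) : C.comp k ⁻¹ᵁ U = ⊥ := by
    rw [eq_bot_iff]
    intro y hy
    refine ((hUV hy).2 ?_).elim
    simp only [Set.mem_iUnion]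
    exact ⟨k, hk, y, rfl⟩
  have hmeet (k l : Fin n) (hk : x ∈ Set.range (C.comp k)) (hl : x ∈ Set.range (C.comp l)) :
      l.val ≤ k.val + 1 := by
    by_contra hlt
    exact Set.disjoint_left.mp (C.disjoint k l (by omega)) hk hl
  refine ⟨U, hU, hxU, fun y hy => (hUV hy).1, ?_⟩
  by_cases hpair : ∃ i j : Fin n, i.val + 1 = j.val ∧ x ∈ Set.range (C.comp i) ∧
      x ∈ Set.range (C.comp j)
  · obtain ⟨i, j, hij, hi, hj⟩ := hpair
    refine .inr ⟨i, j, hij, fun k hki hkj => hbot k fun hk => ?_⟩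
    have h1 := hmeet i k hi hk
    have h2 := hmeet k j hk hj
    have h3 : k.val ≠ i.val := fun h => hki (Fin.ext h)
    have h4 : k.val ≠ j.val := fun h => hkj (Fin.ext h)
    omega
  · obtain ⟨i, hi⟩ := C.covers x
    refine .inl ⟨i, fun k hki => hbot k fun hk => hpair ?_⟩
    have h1 := hmeet i k hi hk
    have h2 := hmeet k i hk hi
    have h3 : k.val ≠ i.val := fun h => hki (Fin.ext h)
    rcases Nat.lt_or_gt_of_ne h3 with h | h
    · exact ⟨k, i, by omega, hk, hi⟩
    · exact ⟨i, k, by omega, hi, hk⟩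

end Chain
end ChainGeometry

/-! ### Comparison of values at a node, seen from either component, inside the fibres on `R`. -/

section AtPoint

variable {X Y : Scheme.{0}}

lemma conj_apply {V V' W W' : ModuleCat.{0} ℂ} (α : V ≅ W) (β : V' ≅ W') (g : V ⟶ V') {x : V}
    {y : V'} {c : ℂ} (h : g x = c • y) : (α.inv ≫ g ≫ β.hom) (α.hom x) = c • β.hom y := by
  simp [h]

lemma map_map_comp_app {A B C : Type*} [Category* A] [Category* B] [Category* C] {F : A ⥤ B}
    {G : B ⥤ C} {H : A ⥤ C} (α : F ⋙ G ≅ H) {x y : A} (f : x ⟶ y) :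
    G.map (F.map f) ≫ (α.app y).hom = (α.app x).hom ≫ H.map f :=
  α.hom.naturality f

/-- The fibre of a pullback at `p` is the fibre at the image of `p`. -/
def fiberIso {p : Spec (.of ℂ) ⟶ X} {φ : X ⟶ Y} {q : Spec (.of ℂ) ⟶ Y} (h : p ≫ φ = q)
    (M : Y.Modules) : (fiber p).obj ((Scheme.Modules.pullback φ).obj M) ≅ (fiber q).obj M :=
  (fiberComp p φ ≪≫ eqToIso (congrArg fiber h)).app M

/-- The value at `p` of a morphism between pullbacks along `φ`, as a map between fibres at the
image of `p`. -/
def atPoint {p : Spec (.of ℂ) ⟶ X} {φ : X ⟶ Y} {q : Spec (.of ℂ) ⟶ Y} (h : p ≫ φ = q)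
    {L M : Y.Modules} (g : (Scheme.Modules.pullback φ).obj L ⟶ (Scheme.Modules.pullback φ).obj M) :
    (fiber q).obj L ⟶ (fiber q).obj M :=
  (fiberIso h L).inv ≫ (fiber p).map g ≫ (fiberIso h M).hom

variable {p : Spec (.of ℂ) ⟶ X} {φ : X ⟶ Y} {q : Spec (.of ℂ) ⟶ Y} (h : p ≫ φ = q)
  {L M : Y.Modules}

lemma secPullback_add (φ : X ⟶ Y) {U : Y.Opens} (s t : Γ(M, U)) :
    secPullback φ (s + t) = secPullback φ s + secPullback φ t :=
  map_add (((pullbackPushforwardAdjunction φ).unit.app M).app U).hom s t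

lemma secPullback_sub (φ : X ⟶ Y) {U : Y.Opens} (s t : Γ(M, U)) :
    secPullback φ (s - t) = secPullback φ s - secPullback φ t :=
  map_sub (((pullbackPushforwardAdjunction φ).unit.app M).app U).hom s t

lemma fiberIso_naturality (f : L ⟶ M) :
    (fiber p).map ((Scheme.Modules.pullback φ).map f) ≫ (fiberIso h M).hom =
      (fiberIso h L).hom ≫ (fiber q).map f :=
  map_map_comp_app _ f

lemma atPoint_map (f : L ⟶ M) : atPoint h ((Scheme.Modules.pullback φ).map f) = (fiber q).map f := by
  rw [atPoint, fiberIso_naturality, Iso.inv_hom_id_assoc]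

lemma atPoint_eq_zero_iff
    (g : (Scheme.Modules.pullback φ).obj L ⟶ (Scheme.Modules.pullback φ).obj M) :
    atPoint h g = 0 ↔ (fiber p).map g = 0 := by
  rw [atPoint, Preadditive.IsIso.comp_left_eq_zero, Preadditive.IsIso.comp_right_eq_zero]

lemma fiber_map_eq_zero_iff_comp (h : p ≫ φ = q) (f : L ⟶ M) :
    (fiber q).map f = 0 ↔ (fiber p).map ((Scheme.Modules.pullback φ).map f) = 0 := by
  rw [← atPoint_map h, atPoint_eq_zero_iff]

lemma fiberIso_refl (M : Y.Modules) :
    (fiberIso (rfl : p ≫ φ = p ≫ φ) M).hom = (fiberComp p φ).hom.app M :=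
  Category.comp_id _

lemma fiberIso_fiberSec {U : Y.Opens} (hm : pt p ∈ φ ⁻¹ᵁ U) (hq : pt q ∈ U) (s : Γ(M, U)) :
    (fiberIso h M).hom (fiberSec p hm (secPullback φ s)) = fiberSec q hq s := by
  subst h
  rw [fiberIso_refl]
  exact fiberComp_fiberSec p φ hq s

/-- Relative to frames defined on `Y`, `atPoint` is multiplication by the value of the coefficient.
Agreement at a node thus becomes an equality of numbers. -/
lemma atPoint_fiberSec (g : (Scheme.Modules.pullback φ).obj L ⟶ (Scheme.Modules.pullback φ).obj M)
    {U : Y.Opens} (hm : pt p ∈ φ ⁻¹ᵁ U) (hq : pt q ∈ U) {e : Γ(L, U)} {e' : Γ(M, U)}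
    {a : Γ(X, φ ⁻¹ᵁ U)} (hg : g.app _ (secPullback φ e) = a • secPullback φ e') :
    atPoint h g (fiberSec q hq e) = val p hm a • fiberSec q hq e' := by
  rw [← fiberIso_fiberSec h hm hq e, ← fiberIso_fiberSec h hm hq e']
  apply conj_apply
  rw [fiber_map_fiberSec, hg, fiberSec_smul]

end AtPoint

/-! ### Gluing morphisms of line bundles along the chain. -/

namespace Chain

variable {n : ℕ} (C : Chain n) {L M : C.R.Modules}

/-- In a local frame the section becomes a function vanishing on all components. -/
lemma section_eq_zero (hM : IsLineBundle M) {U : C.R.Opens} {m : Γ(M, U)}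
    (h : ∀ k, secPullback (C.comp k) m = 0) : m = 0 := by
  apply section_eq_of_local
  intro x hx
  obtain ⟨V, hxV, e, he⟩ := hM x
  refine ⟨U ⊓ V, inf_le_left, ⟨hx, hxV⟩, ?_⟩
  have he' := he.restrict (inf_le_right : U ⊓ V ≤ V)
  obtain ⟨b, hb⟩ := he'.exists_eq_smul (M.presheaf.map (homOfLE (inf_le_left : U ⊓ V ≤ U)).op m)
  have hb0 : b = 0 := by
    apply C.eq_zero_of_app_eq_zero
    intro k
    apply (he'.secPullback (C.comp k)).smul_injective
    rw [← secPullback_smul, ← hb, secPullback_map, h k, zero_smul, map_zero]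
  rw [hb, hb0, zero_smul, map_zero]

lemma hom_eq_zero (hM : IsLineBundle M) {f : L ⟶ M}
    (h : ∀ k, (Scheme.Modules.pullback (C.comp k)).map f = 0) : f = 0 := by
  apply Scheme.Modules.hom_ext
  intro U
  ext s
  apply C.section_eq_zero hM
  intro k
  rw [← pullback_map_secPullback, h k]
  rfl

/-- Morphisms on the components that agree at the nodes are compatible. -/
def Compatible (g : ∀ k, (Scheme.Modules.pullback (C.comp k)).obj L ⟶
    (Scheme.Modules.pullback (C.comp k)).obj M) : Prop :=
  ∀ (i j : Fin n) (h : i.val + 1 = j.val),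
    atPoint (C.nodeLeft_comp h) (g i) = atPoint (C.nodeRight_comp h) (g j)

variable {C} in
-- The coefficients of the `g k` in local frames agree at the node, so they glue to one function on
-- a small affine neighbourhood.
lemma Compatible.exists_coeff {g : ∀ k, (Scheme.Modules.pullback (C.comp k)).obj L ⟶
    (Scheme.Modules.pullback (C.comp k)).obj M} (hg : C.Compatible g) {V : C.R.Opens}
    {e : Γ(L, V)} {e' : Γ(M, V)} (he' : IsFrame M V e')
    {x : C.R} (hx : x ∈ V) :
    ∃ (U : C.R.Opens) (hU : U ≤ V) (b : Γ(C.R, U)), x ∈ U ∧ ∀ k,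
      (g k).app _ (secPullback (C.comp k) (L.presheaf.map (homOfLE hU).op e)) =
        secPullback (C.comp k) (b • M.presheaf.map (homOfLE hU).op e' : Γ(M, U)) := by
  obtain ⟨U, hUa, hxU, hUV, hcase⟩ := C.exists_affine_nbhd x V hx
  have he'U := he'.restrict hUV
  choose a ha using fun k => (he'U.secPullback (C.comp k)).exists_eq_smul
    ((g k).app _ (secPullback (C.comp k) (L.presheaf.map (homOfLE hUV).op e)))
  obtain ⟨b, hb⟩ : ∃ b : Γ(C.R, U), ∀ k, (C.comp k).app U b = a k := by
    rcases hcase with ⟨i, hi⟩ | ⟨i, j, hij, hk⟩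
    · exact C.exists_glue_single hUa i hi a
    · refine C.exists_glue_pair hUa hij hk a fun h₁ h₂ => ?_
      have hq : pt (C.node hij) ∈ U := h₁
      have e1 := atPoint_fiberSec (C.nodeLeft_comp hij) (g i) h₁ hq (ha i)
      have e2 := atPoint_fiberSec (C.nodeRight_comp hij) (g j) h₂ hq (ha j)
      rw [hg i j hij, e2] at e1
      exact ((he'U.fiberSec_bijective (C.node hij) hq).1 e1).symm
  refine ⟨U, hUV, b, hxU, fun k => ?_⟩
  rw [ha k, secPullback_smul, hb k]

variable {C} in
-- The image of a section exists locally by the previous gluing of coefficients and is unique by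
-- `section_eq_zero`; the sheaf property does the rest.
lemma Compatible.exists_section (hL : IsLineBundle L) (hM : IsLineBundle M)
    {g : ∀ k, (Scheme.Modules.pullback (C.comp k)).obj L ⟶
      (Scheme.Modules.pullback (C.comp k)).obj M} (hg : C.Compatible g) {V : C.R.Opens}
    (s : Γ(L, V)) : ∃ m : Γ(M, V), ∀ k,
      secPullback (C.comp k) m = (g k).app _ (secPullback (C.comp k) s) := by
  have := exists_section_of_local (N := M) (V := V) (fun W hW m => ∀ k,
    secPullback (C.comp k) m =
      (g k).app _ (secPullback (C.comp k) (L.presheaf.map (homOfLE hW).op s))) ?_ ?_ ?_ ?_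
  · obtain ⟨m, hm⟩ := this
    exact ⟨m, fun k => by rw [hm k, presheaf_map_self]⟩
  · intro W W' hW h m hm k
    rw [secPullback_map, hm k, ← hom_app_map, ← secPullback_map _ h, presheaf_map_map]
  · intro W hW m m' hm hm'
    rw [← sub_eq_zero]
    apply C.section_eq_zero hM
    intro k
    rw [secPullback_sub, hm k, hm' k, sub_self]
  · intro x hx
    obtain ⟨V₁, hxV₁, e, he⟩ := hL x
    obtain ⟨V₂, hxV₂, e', he'⟩ := hM x
    have h₁ : V ⊓ V₁ ⊓ V₂ ≤ V₁ := inf_le_left.trans inf_le_right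
    have h₂ : V ⊓ V₁ ⊓ V₂ ≤ V₂ := inf_le_right
    have h₃ : V ⊓ V₁ ⊓ V₂ ≤ V := inf_le_left.trans inf_le_left
    obtain ⟨U, hU, b, hxU, hb⟩ := hg.exists_coeff (e := L.presheaf.map (homOfLE h₁).op e)
      (he'.restrict h₂) (x := x) ⟨⟨hx, hxV₁⟩, hxV₂⟩
    obtain ⟨a, ha⟩ := ((he.restrict h₁).restrict hU).exists_eq_smul
      (L.presheaf.map (homOfLE (hU.trans h₃)).op s)
    refine ⟨U, hU.trans h₃, hxU, a • (b • M.presheaf.map (homOfLE hU).op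
      (M.presheaf.map (homOfLE h₂).op e')), fun k => ?_⟩
    rw [ha, secPullback_smul, ← hb k, secPullback_smul, Hom.app_smul]
  · intro m hm k
    rw [presheaf_map_self]
    apply section_eq_of_local
    intro y hy
    obtain ⟨W, hW, hxW, h⟩ := hm (C.comp k y) hy
    refine ⟨C.comp k ⁻¹ᵁ W, (C.comp k).preimage_mono hW, hxW, ?_⟩
    rw [← secPullback_map _ hW, h k, ← hom_app_map, ← secPullback_map _ hW]

/-- Compatible morphisms on the components glue. -/
lemma exists_hom_of_compatible (hL : IsLineBundle L) (hM : IsLineBundle M)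
    {g : ∀ k, (Scheme.Modules.pullback (C.comp k)).obj L ⟶
      (Scheme.Modules.pullback (C.comp k)).obj M} (hg : C.Compatible g) :
    ∃ f : L ⟶ M, ∀ k, (Scheme.Modules.pullback (C.comp k)).map f = g k := by
  choose F hF using fun (V : C.R.Opens) (s : Γ(L, V)) => hg.exists_section hL hM s
  have uniq {V : C.R.Opens} {m m' : Γ(M, V)}
      (h : ∀ k, secPullback (C.comp k) m = secPullback (C.comp k) m') : m = m' := by
    rw [← sub_eq_zero]
    apply C.section_eq_zero hM
    intro k
    rw [secPullback_sub, h k, sub_self]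
  let f : L ⟶ M := homMk F
    (fun U s t => uniq fun k => by
      rw [hF, secPullback_add, secPullback_add, map_add, hF, hF])
    (fun U a s => uniq fun k => by
      rw [hF, secPullback_smul, secPullback_smul, Hom.app_smul, hF])
    (fun U V h s => uniq fun k => by
      rw [hF, secPullback_map, secPullback_map, hom_app_map, hF])
  refine ⟨f, fun k => ?_⟩
  rw [← sub_eq_zero]
  apply eq_zero_of_secPullback
  intro U s
  rw [Hom.sub_app]
  refine sub_eq_zero.mpr ?_
  exact (pullback_map_secPullback (C.comp k) f s).trans (hF U s k)

end Chain

/-! ### Scalars, and maps between one-dimensional fibres. -/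

section Scalar

variable {X Y : Scheme.{0}}

/-- Multiplication by a complex number. -/
def scalar (str : X ⟶ Spec (.of ℂ)) (M : X.Modules) (c : ℂ) : M ⟶ M :=
  homMk (fun U s => const str U c • s) (fun _ _ _ => smul_add _ _ _)
    (fun _ _ _ => smul_comm _ _ _)
    (fun U V h s => by
      rw [Scheme.Modules.map_smul]
      exact congrArg (· • _) (map_const str h c).symm)

lemma scalar_app (str : X ⟶ Spec (.of ℂ)) (M : X.Modules) (c : ℂ) {U : X.Opens} (s : Γ(M, U)) :
    (scalar str M c).app U s = const str U c • s := rfl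

lemma hom_ext_of_generator {V W : ModuleCat.{0} ℂ} {x : V}
    (hx : Function.Surjective fun c : ℂ => c • x) {u v : V ⟶ W} (h : u x = v x) : u = v := by
  ext z
  obtain ⟨c, rfl⟩ := hx z
  exact (u.hom.map_smul c x).trans ((congrArg (c • ·) h).trans (v.hom.map_smul c x).symm)

lemma IsLineBundle.exists_generator {M : X.Modules} (hM : IsLineBundle M)
    (p : Spec (.of ℂ) ⟶ X) : ∃ x : (fiber p).obj M, Function.Bijective fun c : ℂ => c • x := by
  obtain ⟨U, hU, e, he⟩ := hM (pt p)
  exact ⟨_, he.fiberSec_bijective p hU⟩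

lemma IsLineBundle.id_fiber_ne_zero {M : X.Modules} (hM : IsLineBundle M)
    (p : Spec (.of ℂ) ⟶ X) : 𝟙 ((fiber p).obj M) ≠ 0 := by
  obtain ⟨x, hx⟩ := hM.exists_generator p
  intro h
  have h1 : x = 0 := congr($h x)
  exact zero_ne_one (hx.1 (a₁ := 0) (a₂ := 1) (by simp [h1]))

lemma IsLineBundle.exists_eq_smul {M N : X.Modules} (hM : IsLineBundle M) (hN : IsLineBundle N)
    {p : Spec (.of ℂ) ⟶ X} {u : (fiber p).obj M ⟶ (fiber p).obj N} (hu : u ≠ 0)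
    (v : (fiber p).obj M ⟶ (fiber p).obj N) : ∃ c : ℂ, v = c • u := by
  obtain ⟨x, hx⟩ := hM.exists_generator p
  obtain ⟨y, hy⟩ := hN.exists_generator p
  obtain ⟨a, ha⟩ := hy.2 (u x)
  obtain ⟨b, hb⟩ := hy.2 (v x)
  have ha0 : a ≠ 0 := by
    rintro rfl
    exact hu (hom_ext_of_generator hx.2 (ha.symm.trans (zero_smul ℂ y)))
  refine ⟨b / a, hom_ext_of_generator hx.2 ?_⟩
  change v x = (b / a) • u x
  rw [← ha, ← hb, smul_smul, div_mul_cancel₀ _ ha0]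

lemma IsLineBundle.fiber_map_scalar {M : X.Modules} (hM : IsLineBundle M)
    {p : Spec (.of ℂ) ⟶ X} {str : X ⟶ Spec (.of ℂ)} (hp : p ≫ str = 𝟙 _) (c : ℂ) :
    (fiber p).map (scalar str M c) = c • 𝟙 _ := by
  obtain ⟨U, hU, e, he⟩ := hM (pt p)
  refine hom_ext_of_generator (he.fiberSec_bijective p hU).2 ?_
  rw [fiber_map_fiberSec, scalar_app, fiberSec_smul, val_const hp]
  rfl

lemma IsLineBundle.pullback (φ : X ⟶ Y) {M : Y.Modules} (hM : IsLineBundle M) :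
    IsLineBundle ((Scheme.Modules.pullback φ).obj M) := by
  intro x
  obtain ⟨U, hU, e, he⟩ := hM (φ x)
  exact ⟨_, hU, _, he.secPullback φ⟩

lemma IsLineBundle.fiber_map_comp_scalar {M N : X.Modules} (hN : IsLineBundle N) (f : M ⟶ N)
    {p : Spec (.of ℂ) ⟶ X} {str : X ⟶ Spec (.of ℂ)} (hp : p ≫ str = 𝟙 _) (c : ℂ) :
    (fiber p).map (f ≫ scalar str N c) = c • (fiber p).map f := by
  rw [Functor.map_comp, hN.fiber_map_scalar hp, Linear.comp_smul, Category.comp_id]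

/-- Maps between the one-dimensional fibres form a line, so the scalar multiples of a single
morphism not vanishing at `p` realize every value there. -/
lemma exists_hom_of_fiber_map_ne_zero {M N : X.Modules} (hM : IsLineBundle M) (hN : IsLineBundle N)
    {f : M ⟶ N} {p : Spec (.of ℂ) ⟶ X} {str : X ⟶ Spec (.of ℂ)} (hp : p ≫ str = 𝟙 _)
    (hf : (fiber p).map f ≠ 0) (v : (fiber p).obj M ⟶ (fiber p).obj N) :
    ∃ g : M ⟶ N, (fiber p).map g = v := by
  obtain ⟨c, rfl⟩ := hM.exists_eq_smul hN hf v
  exact ⟨_, hN.fiber_map_comp_scalar f hp c⟩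

end Scalar

/-- Dependent choice along a finite chain. -/
lemma exists_chain_choice {n : ℕ} {α : Fin n → Type*} (P : ∀ k, α k → Prop)
    (r : ∀ {i j : Fin n}, i.val + 1 = j.val → α i → α j → Prop)
    (h₀ : ∀ k : Fin n, k.val = 0 → ∃ x, P k x)
    (hs : ∀ (i j : Fin n) (h : i.val + 1 = j.val) x, P i x → ∃ y, P j y ∧ r h x y) :
    ∃ g : ∀ k, α k, (∀ k, P k (g k)) ∧ ∀ (i j : Fin n) (h : i.val + 1 = j.val), r h (g i) (g j) := by
  choose z hz using h₀
  choose next hP hr using hs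
  let G : ∀ (m : ℕ) (hm : m < n), {x : α ⟨m, hm⟩ // P _ x} := fun m => Nat.rec
    (fun hm => ⟨z ⟨0, hm⟩ rfl, hz _ _⟩)
    (fun m ih hm => ⟨next ⟨m, by omega⟩ ⟨m + 1, hm⟩ rfl (ih (by omega)).1 (ih _).2, hP _ _ _ _ _⟩) m
  refine ⟨fun k => (G k.1 k.2).1, fun k => (G k.1 k.2).2, ?_⟩
  rintro ⟨i, hi⟩ ⟨j, hj⟩ h
  obtain rfl : i + 1 = j := h
  exact hr _ _ _ _ _

/-! ### Standard line bundles: vanishing and uniqueness of morphisms. -/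

namespace Chain

variable {n : ℕ} {C : Chain n}

/-- A line bundle of degree one on `R_i` and trivial on the other components. -/
def IsStandard (C : Chain n) (i : Fin n) (M : C.R.Modules) : Prop :=
  IsLineBundle M ∧
    ∀ j, IsTwist ((Scheme.Modules.pullback (C.comp j)).obj M) (if i = j then 1 else 0)

lemma IsStandard.isTwist_one {i : Fin n} {M : C.R.Modules} (hM : C.IsStandard i M) :
    IsTwist ((Scheme.Modules.pullback (C.comp i)).obj M) 1 := by
  simpa using hM.2 i

lemma IsStandard.isTwist_zero {i j : Fin n} {M : C.R.Modules} (hM : C.IsStandard i M) (h : i ≠ j) :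
    IsTwist ((Scheme.Modules.pullback (C.comp j)).obj M) 0 := by
  simpa [h] using hM.2 j

/-- Equal nodes on `R_j` would put a point in both `R_i` and `R_k`, which are disjoint. -/
lemma nodeRight_ne_nodeLeft {i j k : Fin n} (h : i.val + 1 = j.val) (h' : j.val + 1 = k.val) :
    C.nodeRight h ≠ C.nodeLeft h' := by
  intro he
  have h1 : C.nodeLeft h ≫ C.comp i = C.nodeRight h' ≫ C.comp k := by
    rw [nodeLeft_comp, ← nodeRight_comp, he, nodeLeft_comp, ← nodeRight_comp]
  refine Set.disjoint_left.mp (C.disjoint i k (by omega)) ⟨pt (C.nodeLeft h), rfl⟩ ?_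
  rw [← pt_comp, h1, pt_comp]
  exact ⟨_, rfl⟩

lemma IsSmoothPointOn.exists_point {p : Spec (.of ℂ) ⟶ C.R} {i : Fin n}
    (hp : C.IsSmoothPointOn p i) : ∃ a : Spec (.of ℂ) ⟶ P1, a ≫ C.comp i = p ∧
      a ≫ P1.str = 𝟙 _ ∧ ∀ (k : Fin n) (h : k.val + 1 = i.val), C.nodeRight h ≠ a := by
  obtain ⟨a, ha⟩ := hp.factors
  refine ⟨a, ha, ?_, ?_⟩
  · rw [← C.comp_str i, ← Category.assoc, ha, hp.isOver]
  · rintro k h rfl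
    refine Set.disjoint_left.mp (hp.smooth k (by intro e; simp [e] at h)) 
      ⟨IsLocalRing.closedPoint ℂ, rfl⟩ ?_
    · rw [← ha, nodeRight_comp, ← nodeLeft_comp]
      exact ⟨pt (C.nodeLeft h), rfl⟩

section Vanishing

variable {M N : C.R.Modules} {f : M ⟶ N}

/-- The two modules have the same degree on the component `R_k`. -/
def SameDegree (C : Chain n) (M N : C.R.Modules) (k : Fin n) : Prop :=
  ∃ d, IsTwist ((Scheme.Modules.pullback (C.comp k)).obj M) d ∧
    IsTwist ((Scheme.Modules.pullback (C.comp k)).obj N) d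

lemma fiber_map_eq_zero {k : Fin n} (hf : (Scheme.Modules.pullback (C.comp k)).map f = 0)
    {a : Spec (.of ℂ) ⟶ P1} {p : Spec (.of ℂ) ⟶ C.R} (h : a ≫ C.comp k = p) :
    (fiber p).map f = 0 := by
  rw [fiber_map_eq_zero_iff_comp h, hf, Functor.map_zero]

lemma SameDegree.eq_zero {k : Fin n} (hk : C.SameDegree M N k)
    {a : Spec (.of ℂ) ⟶ P1} (ha : a ≫ P1.str = 𝟙 _) {p : Spec (.of ℂ) ⟶ C.R}
    (h : a ≫ C.comp k = p) (hf : (fiber p).map f = 0) :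
    (Scheme.Modules.pullback (C.comp k)).map f = 0 := by
  obtain ⟨d, hM, hN⟩ := hk
  exact hom_eq_zero_of_eq hM hN _ ha ((fiber_map_eq_zero_iff_comp h f).1 hf)

/-- Vanishing passes through each node, and on a component where the degrees agree a zero at the
node forces the morphism to vanish there. -/
lemma eq_zero_of_le {c k : Fin n} (hck : c ≤ k)
    (hs : ∀ l, c < l → l ≤ k → C.SameDegree M N l)
    (hc : (Scheme.Modules.pullback (C.comp c)).map f = 0) :
    (Scheme.Modules.pullback (C.comp k)).map f = 0 := by
  obtain ⟨k, hk⟩ := k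
  induction k with
  | zero =>
    obtain rfl : c = ⟨0, hk⟩ := le_antisymm hck (Nat.zero_le _)
    exact hc
  | succ k ih =>
    rcases hck.eq_or_lt with rfl | hlt
    · exact hc
    · have hck' : c ≤ ⟨k, by omega⟩ := Nat.lt_succ_iff.mp hlt
      have := ih (by omega) hck' fun l hl hl' => hs l hl (hl'.trans (Nat.le_succ k))
      have hnode : (⟨k, by omega⟩ : Fin n).val + 1 = (⟨k + 1, hk⟩ : Fin n).val := rfl
      exact (hs _ hlt le_rfl).eq_zero (C.nodeRight_str hnode) (C.nodeRight_comp hnode)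
        (fiber_map_eq_zero this (C.nodeLeft_comp hnode))

lemma eq_zero_of_ge {c k : Fin n} (hck : k ≤ c)
    (hs : ∀ l, k ≤ l → l < c → C.SameDegree M N l)
    (hc : (Scheme.Modules.pullback (C.comp c)).map f = 0) :
    (Scheme.Modules.pullback (C.comp k)).map f = 0 := by
  obtain ⟨c, hcn⟩ := c
  induction c with
  | zero =>
    obtain rfl : k = ⟨0, hcn⟩ := le_antisymm hck (Nat.zero_le _)
    exact hc
  | succ c ih =>
    rcases hck.eq_or_lt with rfl | hlt
    · exact hc
    · have hck' : k ≤ ⟨c, by omega⟩ := Nat.lt_succ_iff.mp hlt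
      have hnode : (⟨c, by omega⟩ : Fin n).val + 1 = (⟨c + 1, hcn⟩ : Fin n).val := rfl
      refine ih (by omega) hck' (fun l hl hl' => hs l hl (hl'.trans (Nat.lt_succ_self c))) ?_
      exact (hs _ hck' (Nat.lt_succ_self c)).eq_zero (C.nodeLeft_str hnode) (C.nodeLeft_comp hnode)
        (fiber_map_eq_zero hc (C.nodeRight_comp hnode))

lemma IsStandard.sameDegree {i j k : Fin n} (hM : C.IsStandard i M) (hN : C.IsStandard j N)
    (hi : i ≠ k) (hj : j ≠ k) : C.SameDegree M N k :=
  ⟨0, hM.isTwist_zero hi, hN.isTwist_zero hj⟩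

/-- On `R_i` the degree drops from one to zero, so `f` vanishes. On the other components before
`R_j` both bundles are trivial, so the vanishing spreads in both directions until `R_j` stops it. -/
lemma IsStandard.eq_zero_of_lt {i j k : Fin n} (hM : C.IsStandard i M) (hN : C.IsStandard j N)
    (hij : i < j) (hk : k < j) : (Scheme.Modules.pullback (C.comp k)).map f = 0 := by
  have hi : (Scheme.Modules.pullback (C.comp i)).map f = 0 :=
    hom_eq_zero_of_lt hM.isTwist_one (hN.isTwist_zero hij.ne') one_pos _
  rcases le_total i k with h | h
  · exact eq_zero_of_le h (fun l hl hl' => hM.sameDegree hN hl.ne (hl'.trans_lt hk).ne') hi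
  · exact eq_zero_of_ge h (fun l hl hl' => hM.sameDegree hN hl'.ne' (hl'.trans hij).ne') hi

variable {q : Spec (.of ℂ) ⟶ C.R} {z : Fin n}

/-- A morphism to a component further right vanishes at the first component. -/
lemma IsStandard.fiber_first_eq_zero {p : Spec (.of ℂ) ⟶ C.R} {i j a : Fin n}
    (hM : C.IsStandard i M) (hN : C.IsStandard j N) (hij : i < j) (ha : ∀ k, a ≤ k)
    (hp : C.IsSmoothPointOn p a) : (fiber p).map f = 0 := by
  obtain ⟨b, hb⟩ := hp.factors
  exact fiber_map_eq_zero (hM.eq_zero_of_lt hN hij ((ha i).trans_lt hij)) hb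

lemma exists_pred {i j : Fin n} (hij : i < j) : ∃ k : Fin n, k.val + 1 = j.val :=
  ⟨⟨j - 1, by omega⟩, by simp; omega⟩

/-- Vanishing at `q` spreads leftwards through the components after `R_j`, where both bundles are
trivial. On `R_j` the linear form then has two zeros, one at the left node. -/
lemma IsStandard.eq_zero_of_fiber_last {i j : Fin n} (hM : C.IsStandard i M)
    (hN : C.IsStandard j N) (hij : i < j) (hz : ∀ k, k ≤ z) (hq : C.IsSmoothPointOn q z)
    (hf : (fiber q).map f = 0) : f = 0 := by
  obtain ⟨b, hb, hbs, hbn⟩ := hq.exists_point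
  obtain ⟨k, hkj⟩ := exists_pred hij
  have hk0 : (fiber (C.nodeRight hkj)).map ((Scheme.Modules.pullback (C.comp j)).map f) = 0 :=
    (fiber_map_eq_zero_iff_comp (C.nodeRight_comp hkj) f).1 (fiber_map_eq_zero
      (hM.eq_zero_of_lt hN hij (by rw [Fin.lt_def]; omega)) (C.nodeLeft_comp hkj))
  have hright : ∀ l, j < l → (Scheme.Modules.pullback (C.comp l)).map f = 0 := fun l hl => by
    refine eq_zero_of_ge (hz l) (fun m hm _ => ?_) ?_
    · exact hM.sameDegree hN (hij.trans (hl.trans_le hm)).ne (hl.trans_le hm).ne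
    · have := hl.trans_le (hz l)
      exact (hM.sameDegree hN (hij.trans this).ne this.ne).eq_zero hbs hb hf
  have hj : (Scheme.Modules.pullback (C.comp j)).map f = 0 := by
    -- The second zero on `R_j` is `q` itself if `R_j` is the last component, and the right node
    -- otherwise.
    rcases (hz j).eq_or_lt with rfl | hjz
    · exact hom_eq_zero_of_two_zeros (hM.isTwist_zero hij.ne) hN.isTwist_one _
        (C.nodeRight_str hkj) hbs (hbn k hkj) hk0 ((fiber_map_eq_zero_iff_comp hb f).1 hf)
    · have hnode : j.val + 1 = (⟨j.val + 1, lt_of_le_of_lt hjz z.2⟩ : Fin n).val := rfl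
      refine hom_eq_zero_of_two_zeros (hM.isTwist_zero hij.ne) hN.isTwist_one _
        (C.nodeRight_str hkj) (C.nodeLeft_str hnode) (nodeRight_ne_nodeLeft hkj hnode) hk0 ?_
      exact (fiber_map_eq_zero_iff_comp (C.nodeLeft_comp hnode) f).1 (fiber_map_eq_zero
        (hright _ (Nat.lt_succ_self j.val)) (C.nodeRight_comp hnode))
  refine C.hom_eq_zero hN.1 fun l => ?_
  rcases lt_trichotomy l j with h | rfl | h
  · exact hM.eq_zero_of_lt hN hij h
  · exact hj
  · exact hright l h

lemma IsStandard.eq_zero_of_fiber {i : Fin n} (hM : C.IsStandard i M)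
    (hN : C.IsStandard i N) (hq : C.IsSmoothPointOn q z) (hf : (fiber q).map f = 0) : f = 0 := by
  obtain ⟨b, hb, hbs, -⟩ := hq.exists_point
  have hs (k : Fin n) : C.SameDegree M N k := ⟨_, hM.2 k, hN.2 k⟩
  have h := (hs z).eq_zero hbs hb hf
  refine C.hom_eq_zero hN.1 fun l => ?_
  rcases le_total z l with hl | hl
  · exact eq_zero_of_le hl (fun _ _ _ => hs _) h
  · exact eq_zero_of_ge hl (fun _ _ _ => hs _) h

end Vanishing

end Chain

/-! ### Standard line bundles: construction of morphisms, and reversal of the chain. -/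

namespace Chain

variable {n : ℕ} {C : Chain n} {M N : C.R.Modules} {p q : Spec (.of ℂ) ⟶ C.R} {z : Fin n}

lemma atPoint_zero {X Y : Scheme.{0}} {p : Spec (.of ℂ) ⟶ X} {φ : X ⟶ Y} {q : Spec (.of ℂ) ⟶ Y}
    (h : p ≫ φ = q) {L M : Y.Modules} :
    atPoint h (0 : (Scheme.Modules.pullback φ).obj L ⟶ (Scheme.Modules.pullback φ).obj M) = 0 :=
  (atPoint_eq_zero_iff h _).2 (Functor.map_zero _ _ _)

/-- Between bundles trivial on a component there is a nowhere vanishing morphism with prescribed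
nonzero value at a point. -/
lemma exists_nowhere_vanishing (hM : IsLineBundle M) (hN : IsLineBundle N) {k : Fin n}
    (hMk : IsTwist ((Scheme.Modules.pullback (C.comp k)).obj M) 0)
    (hNk : IsTwist ((Scheme.Modules.pullback (C.comp k)).obj N) 0)
    {a : Spec (.of ℂ) ⟶ P1} (ha : a ≫ P1.str = 𝟙 _) (h : a ≫ C.comp k = p)
    {v : (fiber p).obj M ⟶ (fiber p).obj N} (hv : v ≠ 0) :
    ∃ g : (Scheme.Modules.pullback (C.comp k)).obj M ⟶ (Scheme.Modules.pullback (C.comp k)).obj N,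
      (∀ b : Spec (.of ℂ) ⟶ P1, b ≫ P1.str = 𝟙 _ → (fiber b).map g ≠ 0) ∧ atPoint h g = v := by
  obtain ⟨g, hg⟩ := exists_isIso_of_isTwist_zero hMk hNk
  have hN' := hN.pullback (C.comp k)
  have hg0 (b : Spec (.of ℂ) ⟶ P1) : (fiber b).map g ≠ 0 := fun h0 =>
    (hN'.id_fiber_ne_zero b) 
    (by rw [← CategoryTheory.Functor.map_id, ← IsIso.inv_hom_id g, CategoryTheory.Functor.map_comp, h0,
      Limits.comp_zero])
  obtain ⟨c, hc⟩ := hM.exists_eq_smul hN ((atPoint_eq_zero_iff h g).not.2 (hg0 a)) v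
  have hc0 : c ≠ 0 := by
    rintro rfl
    exact hv (hc.trans (zero_smul _ _))
  refine ⟨g ≫ scalar P1.str _ c, fun b hb => ?_, ?_⟩
  · rw [hN'.fiber_map_comp_scalar g hb]
    exact smul_ne_zero hc0 (hg0 b)
  · rw [hc, atPoint, hN'.fiber_map_comp_scalar g ha, Linear.smul_comp, Linear.comp_smul, atPoint]

/-- Glue zero before `R_j`, the linear form vanishing exactly at the left node on `R_j`, and nowhere
vanishing morphisms after it, scaled to match at the nodes. -/
lemma IsStandard.exists_fiber_last_ne_zero {i j : Fin n} (hM : C.IsStandard i M)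
    (hN : C.IsStandard j N) (hij : i < j) (hz : ∀ k, k ≤ z) (hq : C.IsSmoothPointOn q z) :
    ∃ f : M ⟶ N, (fiber q).map f ≠ 0 := by
  -- From `R_j` on, the morphism is required to be nonzero at every `ℂ`-point; the guard `k = j`
  -- exempts only the left node of `R_j`.
  have key := exists_chain_choice
    (α := fun k => (Scheme.Modules.pullback (C.comp k)).obj M ⟶
      (Scheme.Modules.pullback (C.comp k)).obj N)
    (fun k g => (k < j → g = 0) ∧ (j ≤ k → ∀ b : Spec (.of ℂ) ⟶ P1, b ≫ P1.str = 𝟙 _ →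
      (∀ (l : Fin n) (h : l.val + 1 = k.val), k = j → C.nodeRight h ≠ b) → (fiber b).map g ≠ 0))
    (fun {k l} h x y => atPoint (C.nodeLeft_comp h) x = atPoint (C.nodeRight_comp h) y)
  refine (key ?_ ?_).elim fun g ⟨hgP, hgr⟩ => ?_
  rotate_right
  · obtain ⟨f, hf⟩ := C.exists_hom_of_compatible hM.1 hN.1 hgr
    obtain ⟨b, hb, hbs, hbn⟩ := hq.exists_point
    refine ⟨f, fun h0 => ?_⟩
    rw [fiber_map_eq_zero_iff_comp hb, hf] at h0
    exact (hgP z).2 (hz j) b hbs (fun l h _ => hbn l h) h0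
  -- The first component lies strictly before `R_j` because `i < j`, so the chain starts with zero.
  · intro k hk
    exact ⟨0, fun _ => rfl, fun hjk => absurd (hij.trans_le hjk) (by rw [Fin.lt_def]; omega)⟩
  · intro k l h x hx
    rcases lt_trichotomy l j with hl | rfl | hl
    · have hk : k < j := by rw [Fin.lt_def] at *; omega
      exact ⟨0, ⟨fun _ => rfl, fun h' => absurd hl h'.not_gt⟩, by
        rw [hx.1 hk, atPoint_zero, atPoint_zero]⟩
    · obtain ⟨y, hy, hy'⟩ := exists_hom_vanishing_at (hM.isTwist_zero hij.ne) hN.isTwist_one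
        (C.nodeRight_str h)
      refine ⟨y, ⟨fun h' => absurd h' (lt_irrefl _), fun _ b hb hb' => ?_⟩, ?_⟩
      · exact hy' b hb (hb' k h rfl).symm
      · rw [hx.1 (by rw [Fin.lt_def]; omega), atPoint_zero,
          (atPoint_eq_zero_iff (C.nodeRight_comp h) y).2 hy]
    · have hv : atPoint (C.nodeLeft_comp h) x ≠ 0 := by
        rw [Ne, atPoint_eq_zero_iff]
        exact hx.2 (by rw [Fin.lt_def] at hl; rw [Fin.le_def]; omega) _ (C.nodeLeft_str h)
          fun m hm _ => nodeRight_ne_nodeLeft hm h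
      obtain ⟨y, hy, hy'⟩ := exists_nowhere_vanishing hM.1 hN.1
        (hM.isTwist_zero (hij.trans hl).ne) (hN.isTwist_zero hl.ne) (C.nodeRight_str h)
        (C.nodeRight_comp h) hv
      exact ⟨y, ⟨fun h' => absurd h' hl.not_gt, fun _ b hb _ => hy b hb⟩, hy'.symm⟩

lemma IsStandard.exists_fiber_last_eq {i j : Fin n} (hM : C.IsStandard i M)
    (hN : C.IsStandard j N) (hij : i < j) (hz : ∀ k, k ≤ z) (hq : C.IsSmoothPointOn q z)
    (v : (fiber q).obj M ⟶ (fiber q).obj N) : ∃ f : M ⟶ N, (fiber q).map f = v := by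
  obtain ⟨f, hf⟩ := hM.exists_fiber_last_ne_zero hN hij hz hq
  exact exists_hom_of_fiber_map_ne_zero hM.1 hN.1 hq.isOver hf v

lemma IsStandard.exists_end_fiber_eq {i : Fin n} (hM : C.IsStandard i M)
    (hq : C.IsSmoothPointOn q z) (v : (fiber q).obj M ⟶ (fiber q).obj M) :
    ∃ f : M ⟶ M, (fiber q).map f = v := by
  refine exists_hom_of_fiber_map_ne_zero (f := 𝟙 M) hM.1 hM.1 hq.isOver ?_ v
  rw [CategoryTheory.Functor.map_id]
  exact hM.1.id_fiber_ne_zero q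

/-- The chain with the order of its components reversed. -/
def rev (C : Chain n) : Chain n where
  R := C.R
  str := C.str
  isReduced := C.isReduced
  comp i := C.comp i.rev
  isClosedImmersion i := C.isClosedImmersion i.rev
  comp_str i := C.comp_str i.rev
  covers x := by
    obtain ⟨i, hi⟩ := C.covers x
    exact ⟨i.rev, by rwa [Fin.rev_rev]⟩
  meet i j h := by
    have := C.meet j.rev i.rev (by simp only [Fin.val_rev]; omega)
    have h1 : Limits.pullback.fst (C.comp i.rev) (C.comp j.rev) ≫ C.comp i.rev ≫ C.str =
        (Limits.pullbackSymmetry _ _).hom ≫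
          Limits.pullback.fst (C.comp j.rev) (C.comp i.rev) ≫ C.comp j.rev ≫ C.str := by
      rw [Limits.pullbackSymmetry_hom_comp_fst_assoc, Limits.pullback.condition_assoc]
    rw [h1]
    infer_instance
  disjoint i j h := (C.disjoint j.rev i.rev (by simp only [Fin.val_rev]; omega)).symm

lemma IsStandard.rev {i : Fin n} (hM : C.IsStandard i M) : C.rev.IsStandard i.rev M := by
  refine ⟨hM.1, fun j => ?_⟩
  have h := hM.2 j.rev
  have e : (i = j.rev) = (i.rev = j) := by rw [Fin.rev_eq_iff]
  simp only [e] at h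
  exact h

lemma IsSmoothPointOn.rev (hq : C.IsSmoothPointOn q z) : C.rev.IsSmoothPointOn q z.rev := by
  refine ⟨hq.isOver, ?_, fun j hj => hq.smooth j.rev fun h => hj (by rw [← h, Fin.rev_rev])⟩
  obtain ⟨a, ha⟩ := hq.factors
  exact ⟨a, by rw [← ha]; exact congrArg (fun k => a ≫ C.comp k) (Fin.rev_rev z)⟩

end Chain

/-! ### The triangular structure of the spaces `Hom(L i, L j)`. -/

section Matrix

variable {X : Scheme.{0}} {n : ℕ}

/-- The values at `p` and `q` of morphisms between the members of a family of modules: those that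
raise the index vanish at `p` and are determined by arbitrary values at `q`, those that lower the
index vanish at `q` and are determined by arbitrary values at `p`, and those that preserve it are
determined by arbitrary values at either point. -/
structure IsTriangular (L : Fin n → X.Modules) (p q : Spec (.of ℂ) ⟶ X) : Prop where
  eq_zero {i j : Fin n} (f : L i ⟶ L j) (hp : (fiber p).map f = 0) (hq : (fiber q).map f = 0) : f = 0
  zero_left {i j : Fin n} (h : i < j) (f : L i ⟶ L j) : (fiber p).map f = 0
  zero_right {i j : Fin n} (h : j < i) (f : L i ⟶ L j) : (fiber q).map f = 0
  surj_left {i j : Fin n} (h : j ≤ i) : Function.Surjective ((fiber p).map (X := L i) (Y := L j))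
  surj_right {i j : Fin n} (h : i ≤ j) : Function.Surjective ((fiber q).map (X := L i) (Y := L j))
  diag_left {i : Fin n} (f : L i ⟶ L i) (hp : (fiber p).map f = 0) : f = 0
  diag_right {i : Fin n} (f : L i ⟶ L i) (hq : (fiber q).map f = 0) : f = 0

end Matrix

/-- Statements about morphisms lowering the index follow from those raising it by reversing the
chain, which exchanges the roles of `p` and `q`. -/
lemma Chain.IsStandardFamily.isTriangular {n : ℕ} {C : Chain n} {L : Fin n → C.R.Modules}
    (hL : C.IsStandardFamily L) {p q : Spec (.of ℂ) ⟶ C.R} {a z : Fin n} (ha : ∀ k, a ≤ k)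
    (hz : ∀ k, k ≤ z) (hp : C.IsSmoothPointOn p a) (hq : C.IsSmoothPointOn q z) :
    IsTriangular L p q := by
  have h (i : Fin n) : C.IsStandard i (L i) := hL i
  have ha' (k : Fin n) : k ≤ a.rev := by rw [Fin.le_rev_iff]; exact ha _
  have hz' (k : Fin n) : z.rev ≤ k := by rw [Fin.rev_le_iff]; exact hz _
  refine ⟨fun {i j} f hf hf' => ?_, fun {i j} hij f => ?_, fun {i j} hij f => ?_,
    fun {i j} hij v => ?_, fun {i j} hij v => ?_, fun {i} f hf => ?_, fun {i} f hf => ?_⟩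
  · rcases lt_trichotomy i j with hij | rfl | hij
    · exact (h i).eq_zero_of_fiber_last (h j) hij hz hq hf'
    · exact (h i).eq_zero_of_fiber (h i) hp hf
    · exact (h i).rev.eq_zero_of_fiber_last (h j).rev (Fin.rev_lt_rev.2 hij) ha' hp.rev hf
  · exact (h i).fiber_first_eq_zero (h j) hij ha hp
  · exact (h i).rev.fiber_first_eq_zero (h j).rev (Fin.rev_lt_rev.2 hij) hz' hq.rev
  · rcases hij.eq_or_lt with rfl | hij
    · exact (h _).exists_end_fiber_eq hp v
    · exact (h i).rev.exists_fiber_last_eq (h j).rev (Fin.rev_lt_rev.2 hij) ha' hp.rev v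
  · rcases hij.eq_or_lt with rfl | hij
    · exact (h _).exists_end_fiber_eq hq v
    · exact (h i).exists_fiber_last_eq (h j) hij hz hq v
  · exact (h i).eq_zero_of_fiber (h i) hp hf
  · exact (h i).eq_zero_of_fiber (h i) hq hf

/-! ### Matrix calculus for finite direct sums. -/

section Entries

universe u v

variable {A : Type u} [Category.{v} A] [Preadditive A] {n : ℕ} {L : Fin n → A}

/-- The matrix entries of an endomorphism of a direct sum. -/
def entry (D : Limits.Bicone L) (f : D.pt ⟶ D.pt) (i j : Fin n) : L i ⟶ L j :=
  D.ι i ≫ f ≫ D.π j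

variable {D : Limits.Bicone L}

lemma hom_ext_of_entry (hD : D.IsBilimit) {f g : D.pt ⟶ D.pt}
    (h : ∀ i j, entry D f i j = entry D g i j) : f = g := by
  rw [← Category.id_comp f, ← Category.comp_id (𝟙 _ ≫ f), ← Category.id_comp g,
    ← Category.comp_id (𝟙 _ ≫ g), ← Limits.IsBilimit.total hD]
  simp only [Preadditive.sum_comp, Preadditive.comp_sum, Category.assoc]
  refine Finset.sum_congr rfl fun i _ => Finset.sum_congr rfl fun j _ => ?_
  have := h j i
  simp only [entry] at this
  simp only [reassoc_of% this]

lemma entry_comp (hD : D.IsBilimit) (f g : D.pt ⟶ D.pt) (i k : Fin n) :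
    entry D (f ≫ g) i k = ∑ j, entry D f i j ≫ entry D g j k := by
  have : f ≫ g = f ≫ 𝟙 _ ≫ g := by simp
  rw [this, ← Limits.IsBilimit.total hD]
  simp only [entry, Preadditive.sum_comp, Preadditive.comp_sum, Category.assoc]

lemma entry_id_self (i : Fin n) : entry D (𝟙 _) i i = 𝟙 _ := by simp [entry]

/-- The endomorphism of a direct sum with given matrix entries. -/
lemma exists_entry_eq (D : Limits.Bicone L) (m : ∀ i j, L i ⟶ L j) :
    ∃ f : D.pt ⟶ D.pt, ∀ i j, entry D f i j = m i j := by
  refine ⟨∑ i, ∑ j, D.π i ≫ m i j ≫ D.ι j, fun i j => ?_⟩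
  simp only [entry, Preadditive.sum_comp, Preadditive.comp_sum, Category.assoc]
  rw [Finset.sum_eq_single i, Finset.sum_eq_single j]
  · simp
  · intro l _ hl
    simp [Limits.bicone_ι_π_ne D hl]
  · simp
  · intro l _ hl
    refine Finset.sum_eq_zero fun k _ => ?_
    rw [← Category.assoc, Limits.bicone_ι_π_ne D hl.symm, Limits.zero_comp]
  · simp

/-- The diagonal entries of a product of triangular matrices. -/
lemma entry_comp_self (hD : D.IsBilimit) {r : Fin n → Fin n → Prop} [Std.Antisymm r]
    {f g : D.pt ⟶ D.pt} (hf : ∀ i j, ¬ r j i → entry D f i j = 0)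
    (hg : ∀ i j, ¬ r j i → entry D g i j = 0) (i : Fin n) :
    entry D (f ≫ g) i i = entry D f i i ≫ entry D g i i := by
  rw [entry_comp hD, Finset.sum_eq_single i]
  · intro j _ hj
    by_cases h : r j i
    · rw [hg j i fun h' => hj (antisymm h h'), Limits.comp_zero]
    · rw [hf i j h, Limits.zero_comp]
  · simp

end Entries

/-! ### Flag stabilizers as triangular groups. -/

section Flags

variable {n : ℕ} {V : Fin n → ModuleCat.{0} ℂ} {D : Limits.Bicone V}

/-- The sum of the members with index in `s` of a direct sum of vector spaces. -/
lemma mem_iSup_range_ι (hD : D.IsBilimit) (s : Fin n → Prop) (x : D.pt) :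
    x ∈ (⨆ i, ⨆ (_ : s i), LinearMap.range (D.ι i).hom) ↔ ∀ j, ¬ s j → D.π j x = 0 := by
  constructor
  · intro hx j hj
    have : (⨆ i, ⨆ (_ : s i), LinearMap.range (D.ι i).hom) ≤ LinearMap.ker (D.π j).hom := by
      refine iSup₂_le fun i hi => ?_
      rintro _ ⟨y, rfl⟩
      have hij : i ≠ j := by rintro rfl; exact hj hi
      exact congr($(Limits.bicone_ι_π_ne D hij) y)
    exact this hx
  · intro h
    have h1 : x = ∑ j, D.ι j (D.π j x) := by
      conv_lhs => rw [show x = (𝟙 D.pt : D.pt ⟶ D.pt) x from rfl, ← Limits.IsBilimit.total hD]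
      simp
    rw [h1]
    refine Submodule.sum_mem _ fun j _ => ?_
    by_cases hj : s j
    · exact Submodule.mem_iSup_of_mem j (Submodule.mem_iSup_of_mem hj ⟨_, rfl⟩)
    · rw [h j hj, map_zero]
      exact Submodule.zero_mem _

/-- The stabilizer of a flag consists of the triangular automorphisms. -/
lemma mem_stabilizer_iff (hD : D.IsBilimit) (r : Fin n → Fin n → Prop) [Std.Refl r]
    [IsTrans (Fin n) r] (b : Aut D.pt) :
    b ∈ stabilizer (fun k => ⨆ i, ⨆ (_ : r i k), LinearMap.range (D.ι i).hom) ↔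
      (∀ i j, ¬ r j i → entry D b.hom i j = 0) ∧ ∀ i j, ¬ r j i → entry D b.inv i j = 0 := by
  constructor
  · have key (c : Aut D.pt)
        (hc : c ∈ stabilizer (fun k => ⨆ i, ⨆ (_ : r i k), LinearMap.range (D.ι i).hom))
        (i j : Fin n) (hij : ¬ r j i) : entry D c.hom i j = 0 := by
      ext x
      refine (mem_iSup_range_ι hD (fun l => r l i) _).1 ?_ j hij
      exact (hc i).le ⟨_, Submodule.mem_iSup_of_mem i (Submodule.mem_iSup_of_mem (refl i) ⟨x, rfl⟩), rfl⟩
    exact fun hb => ⟨key b hb, key b⁻¹ (inv_mem hb)⟩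
  · rintro ⟨h, h'⟩ k
    have key (c : D.pt ⟶ D.pt) (hc : ∀ i j, ¬ r j i → entry D c i j = 0) :
        (⨆ i, ⨆ (_ : r i k), LinearMap.range (D.ι i).hom) ≤
          (⨆ i, ⨆ (_ : r i k), LinearMap.range (D.ι i).hom).comap c.hom := by
      refine iSup₂_le fun i hi => ?_
      rintro _ ⟨y, rfl⟩
      refine (mem_iSup_range_ι hD (fun l => r l k) _).2 fun j hj => ?_
      exact congr($(hc i j fun hji => hj (_root_.trans hji hi)) y)
    -- Triangularity of `b` only maps each member into itself; that of the inverse gives equality.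
    refine le_antisymm (Submodule.map_le_iff_le_comap.2 (key b.hom h)) fun x hx => ?_
    exact ⟨b.inv x, key b.inv h' hx, congr($(b.inv_hom_id) x)⟩

end Flags

/-! ### Projection of a triangular group to the torus. -/

section Torus

universe u v

variable {A : Type u} [Category.{v} A] [Preadditive A] {n : ℕ} {L : Fin n → A}
  {D : Limits.Bicone L} {F : A ⥤ ModuleCat.{0} ℂ} [F.Additive]

lemma isBilimit_mapBicone (F : A ⥤ ModuleCat.{0} ℂ) [F.Additive] (hD : D.IsBilimit) :
    Nonempty (F.mapBicone D).IsBilimit :=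
  ⟨Limits.isBilimitOfPreserves F hD⟩

lemma entry_map (f : D.pt ⟶ D.pt) (i j : Fin n) :
    entry (F.mapBicone D) (F.map f) i j = F.map (entry D f i j) := by
  have h : F.map (entry D f i j) = F.map (D.ι i) ≫ F.map f ≫ F.map (D.π j) := by
    rw [entry, F.map_comp, F.map_comp]
  exact h.symm

/-- A group of triangular automorphisms of `F(E)` has a unique projection to the torus. -/
lemma exists_torusProjection (hD : D.IsBilimit)
    (hF : ∀ i, Function.Bijective (F.map (X := L i) (Y := L i)))
    (r : Fin n → Fin n → Prop) [Std.Antisymm r] (B : Subgroup (Aut (F.obj D.pt)))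
    (hB : ∀ b ∈ B, ∀ i j, ¬ r j i → entry (F.mapBicone D) b.hom i j = 0) :
    ∃ π₀ : B →* (∀ i, Aut (L i)), ∀ π : B →* (∀ i, Aut (L i)),
      (∀ b i, entry (F.mapBicone D) b.1.hom i i = F.map (π b i).hom) ↔ π = π₀ := by
  obtain ⟨hD'⟩ := isBilimit_mapBicone F hD
  choose t ht using fun (b : B) i => (hF i).2 (entry (F.mapBicone D) b.1.hom i i)
  -- Multiplication in `Aut` composes from right to left, which reverses the factors.
  have hmul (b c : B) (i : Fin n) : t (b * c) i = t c i ≫ t b i := by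
    apply (hF i).1
    rw [F.map_comp, ht, ht, ht]
    exact entry_comp_self hD' (hB c c.2) (hB b b.2) i
  have hone (i : Fin n) : t 1 i = 𝟙 _ := by
    apply (hF i).1
    rw [ht, F.map_id]
    exact entry_id_self (D := F.mapBicone D) i
  -- Invertibility of the diagonal entries comes from `b⁻¹` also lying in the triangular group `B`.
  let π₀ : B →* (∀ i, Aut (L i)) := MonoidHom.mk'
    (fun b i => ⟨t b i, t b⁻¹ i, by rw [← hmul, inv_mul_cancel, hone],
      by rw [← hmul, mul_inv_cancel, hone]⟩)
    (fun b c => funext fun i => Iso.ext (hmul b c i))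
  refine ⟨π₀, fun π => ⟨fun h => ?_, ?_⟩⟩
  · ext b i
    apply (hF i).1
    rw [← h b i]
    exact (ht b i).symm
  · rintro rfl b i
    exact (ht b i).symm

end Torus

/-! ### Evaluation at the two points and its image. -/

namespace IsTriangular

variable {X : Scheme.{0}} {n : ℕ} {L : Fin n → X.Modules} {p q : Spec (.of ℂ) ⟶ X}
  {D : Limits.Bicone L}

lemma hom_ext (hL : IsTriangular L p q) (hD : D.IsBilimit) {f g : D.pt ⟶ D.pt}
    (hp : (fiber p).map f = (fiber p).map g) (hq : (fiber q).map f = (fiber q).map g) : f = g := by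
  refine hom_ext_of_entry hD fun i j => sub_eq_zero.1 (hL.eq_zero _ ?_ ?_)
  · rw [Functor.map_sub, ← entry_map, ← entry_map, hp, sub_self]
  · rw [Functor.map_sub, ← entry_map, ← entry_map, hq, sub_self]

lemma eval_injective (hL : IsTriangular L p q) (hD : D.IsBilimit) :
    Function.Injective (eval D.pt p q) := by
  intro σ τ h
  apply Iso.ext
  have h1 : (fiber p).mapIso σ = (fiber p).mapIso τ := congrArg Prod.fst h
  have h2 : (fiber q).mapIso σ = (fiber q).mapIso τ := congrArg Prod.snd h
  exact hL.hom_ext hD (congrArg Iso.hom h1) (congrArg Iso.hom h2)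

lemma bijective_left (hL : IsTriangular L p q) (i : Fin n) :
    Function.Bijective ((fiber p).map (X := L i) (Y := L i)) := by
  refine ⟨fun f g h => sub_eq_zero.1 (hL.diag_left _ ?_), hL.surj_left le_rfl⟩
  rw [Functor.map_sub, h, sub_self]

lemma bijective_right (hL : IsTriangular L p q) (i : Fin n) :
    Function.Bijective ((fiber q).map (X := L i) (Y := L i)) := by
  refine ⟨fun f g h => sub_eq_zero.1 (hL.diag_right _ ?_), hL.surj_right le_rfl⟩
  rw [Functor.map_sub, h, sub_self]

lemma mem_borelPlus_iff (hD : D.IsBilimit) (b : Aut ((fiber p).obj D.pt)) :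
    b ∈ borelPlus D p ↔ (∀ i j, ¬ j ≤ i → entry ((fiber p).mapBicone D) b.hom i j = 0) ∧
      ∀ i j, ¬ j ≤ i → entry ((fiber p).mapBicone D) b.inv i j = 0 := by
  obtain ⟨hD'⟩ := isBilimit_mapBicone (fiber p) hD
  exact mem_stabilizer_iff hD' (· ≤ ·) b

lemma mem_borelMinus_iff (hD : D.IsBilimit) (b : Aut ((fiber q).obj D.pt)) :
    b ∈ borelMinus D q ↔ (∀ i j, ¬ j ≥ i → entry ((fiber q).mapBicone D) b.hom i j = 0) ∧
      ∀ i j, ¬ j ≥ i → entry ((fiber q).mapBicone D) b.inv i j = 0 := by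
  obtain ⟨hD'⟩ := isBilimit_mapBicone (fiber q) hD
  exact mem_stabilizer_iff hD' (· ≥ ·) b

/-- A lower triangular endomorphism of `E_p` and an upper triangular endomorphism of `E_q` whose
diagonal entries come from common endomorphisms of the summands come from an endomorphism of `E`. -/
lemma exists_hom (hL : IsTriangular L p q) (hD : D.IsBilimit)
    {b : (fiber p).obj D.pt ⟶ (fiber p).obj D.pt} {c : (fiber q).obj D.pt ⟶ (fiber q).obj D.pt}
    (hb : ∀ i j, ¬ j ≤ i → entry ((fiber p).mapBicone D) b i j = 0)
    (hc : ∀ i j, ¬ j ≥ i → entry ((fiber q).mapBicone D) c i j = 0) (t : ∀ i, L i ⟶ L i)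
    (htb : ∀ i, entry ((fiber p).mapBicone D) b i i = (fiber p).map (t i))
    (htc : ∀ i, entry ((fiber q).mapBicone D) c i i = (fiber q).map (t i)) :
    ∃ f : D.pt ⟶ D.pt, (fiber p).map f = b ∧ (fiber q).map f = c := by
  -- An entry above or below the diagonal is prescribed at the point where evaluation is surjective;
  -- at the other point both sides vanish. On the diagonal `t i` serves both points.
  have key (i j : Fin n) : ∃ f : L i ⟶ L j,
      (fiber p).map f = entry ((fiber p).mapBicone D) b i j ∧
      (fiber q).map f = entry ((fiber q).mapBicone D) c i j := by
    rcases lt_trichotomy i j with h | rfl | h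
    · obtain ⟨f, hf⟩ := hL.surj_right h.le (entry ((fiber q).mapBicone D) c i j)
      exact ⟨f, (hL.zero_left h f).trans (hb i j h.not_ge).symm, hf⟩
    · exact ⟨t i, (htb i).symm, (htc i).symm⟩
    · obtain ⟨f, hf⟩ := hL.surj_left h.le (entry ((fiber p).mapBicone D) b i j)
      exact ⟨f, hf, (hL.zero_right h f).trans (hc i j h.not_ge).symm⟩
  choose m hmp hmq using key
  obtain ⟨f, hf⟩ := exists_entry_eq D m
  obtain ⟨hDp⟩ := isBilimit_mapBicone (fiber p) hD
  obtain ⟨hDq⟩ := isBilimit_mapBicone (fiber q) hD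
  refine ⟨f, hom_ext_of_entry hDp fun i j => ?_, hom_ext_of_entry hDq fun i j => ?_⟩
  · exact (entry_map f i j).trans ((congrArg _ (hf i j)).trans (hmp i j))
  · exact (entry_map f i j).trans ((congrArg _ (hf i j)).trans (hmq i j))

lemma eval_mem (hL : IsTriangular L p q) (hD : D.IsBilimit) (σ : Aut D.pt) :
    (eval D.pt p q σ).1 ∈ borelPlus D p ∧ (eval D.pt p q σ).2 ∈ borelMinus D q := by
  rw [mem_borelPlus_iff hD, mem_borelMinus_iff hD]
  refine ⟨⟨fun i j h => ?_, fun i j h => ?_⟩, fun i j h => ?_, fun i j h => ?_⟩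
  · exact (entry_map σ.hom i j).trans (hL.zero_left (not_le.1 h) _)
  · exact (entry_map σ.inv i j).trans (hL.zero_left (not_le.1 h) _)
  · exact (entry_map σ.hom i j).trans (hL.zero_right (not_le.1 h) _)
  · exact (entry_map σ.inv i j).trans (hL.zero_right (not_le.1 h) _)

/-- The pairs `(b, c)` and `(b⁻¹, c⁻¹)` both lift to endomorphisms. These are mutually inverse
because endomorphisms are determined by their two values. -/
lemma exists_eval_eq (hL : IsTriangular L p q) (hD : D.IsBilimit)
    {πp : borelPlus D p →* (∀ i, Aut (L i))} {πm : borelMinus D q →* (∀ i, Aut (L i))}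
    (hπp : IsTorusProjection D p (borelPlus D p) πp)
    (hπm : IsTorusProjection D q (borelMinus D q) πm) {b : borelPlus D p} {c : borelMinus D q}
    (h : πp b = πm c) : ∃ σ, eval D.pt p q σ = (b.1, c.1) := by
  have key (b : borelPlus D p) (c : borelMinus D q) (h : πp b = πm c) :
      ∃ f : D.pt ⟶ D.pt, (fiber p).map f = b.1.hom ∧ (fiber q).map f = c.1.hom :=
    hL.exists_hom hD ((mem_borelPlus_iff hD _).1 b.2).1 ((mem_borelMinus_iff hD _).1 c.2).1
      (fun i => (πp b i).hom) (hπp b) (h ▸ hπm c)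
  obtain ⟨f, hfp, hfq⟩ := key b c h
  obtain ⟨g, hgp, hgq⟩ := key b⁻¹ c⁻¹ (by rw [map_inv, map_inv, h])
  have hg1 : (fiber p).map g = b.1.inv := hgp
  have hg2 : (fiber q).map g = c.1.inv := hgq
  refine ⟨⟨f, g, hL.hom_ext hD ?_ ?_, hL.hom_ext hD ?_ ?_⟩, Prod.ext (Iso.ext hfp) (Iso.ext hfq)⟩
  · rw [Functor.map_comp, hfp, hg1, CategoryTheory.Functor.map_id]
    exact b.1.hom_inv_id
  · rw [Functor.map_comp, hfq, hg2, CategoryTheory.Functor.map_id]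
    exact c.1.hom_inv_id
  · rw [Functor.map_comp, hfp, hg1, CategoryTheory.Functor.map_id]
    exact b.1.inv_hom_id
  · rw [Functor.map_comp, hfq, hg2, CategoryTheory.Functor.map_id]
    exact c.1.inv_hom_id

/-- On the image of the evaluation map the two torus projections agree. -/
lemma torusProjection_eq (hL : IsTriangular L p q)
    {πp : borelPlus D p →* (∀ i, Aut (L i))} {πm : borelMinus D q →* (∀ i, Aut (L i))}
    (hπp : IsTorusProjection D p (borelPlus D p) πp)
    (hπm : IsTorusProjection D q (borelMinus D q) πm) {b : borelPlus D p} {c : borelMinus D q}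
    {σ : Aut D.pt} (hσ : eval D.pt p q σ = (b.1, c.1)) : πp b = πm c := by
  have hb : (fiber p).mapIso σ = b.1 := congrArg Prod.fst hσ
  have hc : (fiber q).mapIso σ = c.1 := congrArg Prod.snd hσ
  funext i
  apply Iso.ext
  have h1 : (πp b i).hom = entry D σ.hom i i := by
    apply (hL.bijective_left i).1
    rw [← hπp b i, ← hb, ← entry_map]
    rfl
  have h2 : (πm c i).hom = entry D σ.hom i i := by
    apply (hL.bijective_right i).1
    rw [← hπm c i, ← hc, ← entry_map]
    rfl
  rw [h1, h2]

/-- Each equivalence with an equality expresses existence and uniqueness of a torus projection at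
once. -/
theorem range_eval (hL : IsTriangular L p q) (hD : D.IsBilimit) :
    ∃ (πp : borelPlus D p →* (∀ i, Aut (L i))) (πm : borelMinus D q →* (∀ i, Aut (L i))),
      (∀ π, IsTorusProjection D p (borelPlus D p) π ↔ π = πp) ∧
      (∀ π, IsTorusProjection D q (borelMinus D q) π ↔ π = πm) ∧
      Set.range (eval D.pt p q) = Prod.map Subtype.val Subtype.val ''
        ((πp.prodMap πm) ⁻¹' Set.diagonal (∀ i, Aut (L i))) := by
  obtain ⟨πp, hπp⟩ := exists_torusProjection hD hL.bijective_left (· ≤ ·) (borelPlus D p)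
    fun b hb => ((mem_borelPlus_iff hD b).1 hb).1
  obtain ⟨πm, hπm⟩ := exists_torusProjection hD hL.bijective_right (· ≥ ·) (borelMinus D q)
    fun b hb => ((mem_borelMinus_iff hD b).1 hb).1
  refine ⟨πp, πm, hπp, hπm, Set.ext fun x => ⟨?_, ?_⟩⟩
  · rintro ⟨σ, rfl⟩
    obtain ⟨h1, h2⟩ := hL.eval_mem hD σ
    exact ⟨(⟨_, h1⟩, ⟨_, h2⟩),
      hL.torusProjection_eq ((hπp πp).2 rfl) ((hπm πm).2 rfl) (σ := σ) rfl, rfl⟩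
  · rintro ⟨⟨b, c⟩, h, rfl⟩
    exact hL.exists_eval_eq hD ((hπp πp).2 rfl) ((hπm πm).2 rfl) h

end IsTriangular

end GiesekerChain

end

/-! ### The theorem, with the end components indexed by `0` and `n - 1`. -/

theorem mainTheorem6 (n : ℕ) (hn : 0 < n) (C : GiesekerChain.Chain n)
    (p q : AlgebraicGeometry.Spec (.of ℂ) ⟶ C.R) (hpq : p ≠ q)
    (hp : C.IsSmoothPointOn p ⟨0, hn⟩) (hq : C.IsSmoothPointOn q ⟨n - 1, Nat.sub_one_lt_of_lt hn⟩)
    (L : Fin n → C.R.Modules) (hL : C.IsStandardFamily L)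
    (D : CategoryTheory.Limits.Bicone L) (hD : D.IsBilimit) :
    Function.Injective (GiesekerChain.eval D.pt p q) ∧
    ∃ (πp : GiesekerChain.borelPlus D p →* (∀ i, CategoryTheory.Aut (L i)))
      (πm : GiesekerChain.borelMinus D q →* (∀ i, CategoryTheory.Aut (L i))),
      (∀ π, GiesekerChain.IsTorusProjection D p (GiesekerChain.borelPlus D p) π ↔ π = πp) ∧
      (∀ π, GiesekerChain.IsTorusProjection D q (GiesekerChain.borelMinus D q) π ↔ π = πm) ∧
      Set.range (GiesekerChain.eval D.pt p q) =
        Prod.map Subtype.val Subtype.val ''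
          ((πp.prodMap πm) ⁻¹' Set.diagonal (∀ i, CategoryTheory.Aut (L i))) := by
  have h : GiesekerChain.IsTriangular L p q :=
    hL.isTriangular (fun k => Nat.zero_le k.val) (fun k => Nat.le_sub_one_of_lt k.2) hp hq
  exact ⟨h.eval_injective hD, h.range_eval hD⟩
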